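/- **Theorem (Modified Hedberg inequality).** Let $n\ge 1$ be an integer, let $0<s_1<s<n$ and $\beta>0$ be real numbers, and put $$\theta=\frac{s-s_1}{\beta+s}\in(0,1).$$ For $t>0$ let $h_t(x)=(4\pi t)^{-n/2}e^{-|x|^2/(4t)}$ be the heat kernel on $\mathbb{R}^n$, and for a tempered distribution $T\in\mathcal{S}'(\mathbb{R}^n)$ let $$\|T\|_{\dot B^{-\beta,\infty}_{\infty}}=\sup_{t>0}\,t^{\beta/2}\,\|h_t*T\|_{L^\infty(\mathbb{R}^n)}\in[0,\infty],$$ where $(h_t*T)(x)=\langle T,h_t(x-\cdot)\rangle$. The space $\dot B^{-\beta,\infty}_{\infty}(\mathbb{R}^n)$ consists of the tempered distributions for which this is finite. For $\sigma>0$, the fractional power $(-\Delta)^{\sigma/2}T$ is the tempered distribution whose Fourier transform is $|\xi|^{\sigma}\widehat{T}(\xi)$ (with the Fourier transform normalized so that $-\Delta$ has symbol $|\xi|^2$); here, since $|\xi|^\sigma$ is not smooth at the origin, the product $|\xi|^\sigma\widehat T$ is understood as the limit in $\mathcal{S}'(\mathbb{R}^n)$, as $\varepsilon\to0^+$, of $(1-\chi(\xi/\varepsilon))|\xi|^\sigma\widehat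 T$, for every $\chi\in C_c^\infty(\mathbb{R}^n)$ equal to $1$ near the origin. For a locally integrable function $g$ let $$\mathcal{M}(g)(x)=\sup_{B\ni x}\frac1{|B|}\int_B|g(y)|\,dy\in[0,\infty],$$ the supremum being over all open balls $B$ containing $x$, be the Hardy–Littlewood maximal function. There is a constant $C>0$, depending only on $n,s,s_1,\beta$, with the following property. Let $f:\mathbb{R}^n\to\mathbb{R}$ be a $C^\infty$ function that is a tempered distribution (that is, the functional $\varphi\mapsto\int f\varphi$ on $C_c^\infty(\mathbb{R}^n)$ extends to an element of $\mathcal{S}'(\mathbb{R}^n)$) and that belongs to $\dot B^{-\beta,\infty}_{\infty}(\mathbb{R}^n)$. Then $(-\Delta)^{s_1/2}f$ and $(-\Delta)^{s/2}f$ exist and are continuous functions, and for every $x\in\mathbb{R}^n$ $$\big|(-\Delta)^{s_1/2}f(x)\big|^{\frac1{1-\theta}}\le C\,\mathcal{M}\big((-\Delta)^{s/2}f\big)(x)\,\|f\|_{\dot B^{-\beta,\infty}_{\infty}}^{\frac{\theta}{1-\theta}},$$ where the right-hand side is computed in $[0,\infty]$ with the convention $\infty\cdot 0=0$. -/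

import Mathlib

open MeasureTheory Filter Topology
open scoped SchwartzMap ENNReal ContDiff

noncomputable section

/-- `ℝⁿ` with its Euclidean norm and Lebesgue measure. -/
abbrev Rn (n : ℕ) : Type := EuclideanSpace ℝ (Fin n)

/-- The tempered distribution `T` is the locally integrable function `f`:
`⟨T, φ⟩ = ∫ f φ` for every smooth compactly supported test function `φ`.
(These test functions are dense in the Schwartz space, so `f` determines `T`.) -/
def IsRepresentedBy {n : ℕ} (T : 𝓢'(Rn n, ℂ)) (f : Rn n → ℂ) : Prop :=
  LocallyIntegrable f volume ∧
    ∀ φ : 𝓢(Rn n, ℂ), HasCompactSupport φ → T φ = ∫ x, φ x * f x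

/-- The gaussian (heat) kernel `h_t(x) = (4πt)^{-n/2} exp(-|x|²/(4t))`. -/
def heatFun (n : ℕ) (t : ℝ) (x : Rn n) : ℝ :=
  (4 * Real.pi * t) ^ (-(n : ℝ) / 2) * Real.exp (-(‖x‖ ^ 2 / (4 * t)))

theorem heatFun_contDiff (n : ℕ) (t : ℝ) : ContDiff ℝ ∞ (heatFun n t) := by
  unfold heatFun
  exact contDiff_const.mul (Real.contDiff_exp.comp ((contDiff_norm_sq ℝ).div_const _).neg)

theorem exp_neg_iteratedFDeriv_norm (i : ℕ) (u : ℝ) :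
    ‖iteratedFDeriv ℝ i (fun v : ℝ => Real.exp (-v)) u‖ = Real.exp (-u) := by
  rw [norm_iteratedFDeriv_eq_norm_iteratedDeriv]
  have h := iteratedDeriv_comp_neg (𝕜 := ℝ) i Real.exp u
  rw [h]
  simp [iteratedDeriv_eq_iterate, Real.iter_deriv_exp]

theorem pow_mul_exp_neg_sq_bound (m : ℕ) {a : ℝ} (ha : 0 < a) :
    ∃ C : ℝ, ∀ r : ℝ, 0 ≤ r → (1 + r) ^ m * Real.exp (-(a * r ^ 2)) ≤ C := by
  have h1 : ∀ r : ℝ, 0 ≤ r → (1 + r) ^ m * Real.exp (-(a * r ^ 2)) ≤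
      m.factorial * Real.exp (1 + 1 / a) := by
    intro r hr
    have hp : (1 + r) ^ m ≤ m.factorial * Real.exp (1 + r) := by
      have := Real.pow_div_factorial_le_exp (1 + r) (by positivity) m
      rw [div_le_iff₀ (by positivity)] at this
      linarith
    have hq : 1 + r + -(a * r ^ 2) ≤ 1 + 1 / a := by
      have h2 : r ≤ a * r ^ 2 + 1 / a := by
        have h3 : a * r ^ 2 + 1 / a - r = (a * r - 1 / 2) ^ 2 / a + 3 / (4 * a) := by
          field_simp; ring
        have h4 : 0 ≤ (a * r - 1 / 2) ^ 2 / a + 3 / (4 * a) := by positivity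
        linarith
      linarith
    calc (1 + r) ^ m * Real.exp (-(a * r ^ 2))
        ≤ m.factorial * Real.exp (1 + r) * Real.exp (-(a * r ^ 2)) := by gcongr
      _ = m.factorial * Real.exp (1 + r + -(a * r ^ 2)) := by rw [mul_assoc, ← Real.exp_add]
      _ ≤ m.factorial * Real.exp (1 + 1 / a) := by gcongr
  exact ⟨_, h1⟩

theorem heatFun_decay (n : ℕ) {t : ℝ} (ht : 0 < t) (k m : ℕ) :
    ∃ C : ℝ, ∀ x : Rn n, ‖x‖ ^ k * ‖iteratedFDeriv ℝ m (heatFun n t) x‖ ≤ C := by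
  set c : ℝ := (4 * Real.pi * t) ^ (-(n : ℝ) / 2) with hc
  have hc0 : 0 ≤ c := by positivity
  set q : Rn n → ℝ := fun x => ‖x‖ ^ 2 / (4 * t) with hq
  have hqs : ContDiff ℝ ∞ q := (contDiff_norm_sq ℝ).div_const _
  have hqt : q.HasTemperateGrowth := by
    have : q = fun x => ‖x‖ ^ 2 * (4 * t)⁻¹ := by
      funext x; simp [hq, div_eq_mul_inv]
    rw [this]; fun_prop
  obtain ⟨l, D, hD0, hD⟩ := hqt.norm_iteratedFDeriv_le_uniform m
  obtain ⟨B, hB⟩ := pow_mul_exp_neg_sq_bound (k + l * m) (a := 1 / (4 * t)) (by positivity)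
  have hes : ContDiff ℝ ∞ (fun v : ℝ => Real.exp (-v)) :=
    Real.contDiff_exp.comp contDiff_neg
  refine ⟨c * (m.factorial * (max 1 D) ^ m * B), fun x => ?_⟩
  have hfun : heatFun n t = fun x => c • ((fun v : ℝ => Real.exp (-v)) ∘ q) x := by
    funext y; simp [heatFun, hq, hc]
  have hx : (1 : ℝ) ≤ 1 + ‖x‖ := by linarith [norm_nonneg x]
  have hbound := norm_iteratedFDeriv_comp_le (𝕜 := ℝ) (n := m) (N := ∞)
    (C := Real.exp (-(q x))) (D := max 1 D * (1 + ‖x‖) ^ l) hes hqs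
    (by exact_mod_cast le_top) x
    (fun i _ => (exp_neg_iteratedFDeriv_norm i (q x)).le)
    (fun i hi1 him => by
      have h1 : (1 : ℝ) ≤ max 1 D * (1 + ‖x‖) ^ l :=
        one_le_mul_of_one_le_of_one_le (le_max_left _ _) (one_le_pow₀ hx)
      calc ‖iteratedFDeriv ℝ i q x‖ ≤ D * (1 + ‖x‖) ^ l := hD i him x
        _ ≤ max 1 D * (1 + ‖x‖) ^ l := by gcongr; exact le_max_right _ _
        _ ≤ _ := le_self_pow₀ h1 (by omega))
  rw [hfun, iteratedFDeriv_const_smul_apply' ((hes.comp hqs).contDiffAt.of_le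
    (by exact_mod_cast le_top)), norm_smul, Real.norm_of_nonneg hc0]
  have hBx := hB ‖x‖ (norm_nonneg x)
  have hqx : 1 / (4 * t) * ‖x‖ ^ 2 = q x := by simp only [hq]; ring
  rw [hqx] at hBx
  calc ‖x‖ ^ k * (c * ‖iteratedFDeriv ℝ m ((fun v : ℝ => Real.exp (-v)) ∘ q) x‖)
      ≤ (1 + ‖x‖) ^ k * (c * (m.factorial * Real.exp (-(q x)) *
          (max 1 D * (1 + ‖x‖) ^ l) ^ m)) := by
        gcongr
        linarith
    _ = c * (m.factorial * (max 1 D) ^ m *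
          ((1 + ‖x‖) ^ (k + l * m) * Real.exp (-(q x)))) := by
        rw [mul_pow, pow_add, pow_mul]; ring
    _ ≤ _ := by gcongr

/-- The heat kernel at time `t > 0`, as a complex-valued Schwartz function. -/
def heatKernel (n : ℕ) (t : ℝ) (ht : 0 < t) : 𝓢(Rn n, ℂ) :=
  SchwartzMap.postcompCLM (𝕜 := ℝ) Complex.ofRealCLM
    { toFun := heatFun n t
      smooth' := heatFun_contDiff n t
      decay' := heatFun_decay n ht }

theorem heatKernel_apply (n : ℕ) (t : ℝ) (ht : 0 < t) (x : Rn n) :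
    heatKernel n t ht x = (heatFun n t x : ℂ) := rfl

/-- `(h_t * T)(x) = ⟨T, h_t(x - ·)⟩`; since `h_t` is even, `h_t(x - y) = h_t(y - x)`. -/
def heatConv {n : ℕ} (T : 𝓢'(Rn n, ℂ)) (t : ℝ) (ht : 0 < t) (x : Rn n) : ℂ :=
  T ((heatKernel n t ht).compSubConstCLM ℂ x)

/-- The norm `‖T‖ = sup_{t > 0} t^{β/2} ‖h_t * T‖_{L^∞}` of the homogeneous Besov space
`Ḃ^{-β,∞}_∞`, as an extended nonnegative number; `T` is in the space iff it is finite. -/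
def besovNorm {n : ℕ} (β : ℝ) (T : 𝓢'(Rn n, ℂ)) : ℝ≥0∞ :=
  ⨆ (t : ℝ) (ht : 0 < t), ENNReal.ofReal (t ^ (β / 2)) * eLpNorm (heatConv T t ht) ⊤ volume

/-- The (uncentred) Hardy-Littlewood maximal function
`M g (x) = sup_{B ∋ x} |B|⁻¹ ∫_B |g|`, the supremum being over all open balls containing `x`. -/
def hlMaximal {n : ℕ} (g : Rn n → ℂ) (x : Rn n) : ℝ≥0∞ :=
  ⨆ (c : Rn n) (r : ℝ) (_ : x ∈ Metric.ball c r),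
    (volume (Metric.ball c r))⁻¹ * ∫⁻ y in Metric.ball c r, ‖g y‖ₑ

/-- The symbol `|ξ|^s` of `(-Δ)^{s/2}`, truncated near the origin by `1 - χ(ξ/ε)`. Mathlib's
Fourier transform has the phase `exp(-2πi x·ξ)`, so the symbol of `-Δ` is `(2π|ξ|)²`. -/
def truncSymbol {n : ℕ} (s : ℝ) (χ : Rn n → ℝ) (ε : ℝ) (ξ : Rn n) : ℂ :=
  (((1 - χ (ε⁻¹ • ξ)) * (2 * Real.pi * ‖ξ‖) ^ s : ℝ) : ℂ)

/-- `U = (-Δ)^{s/2} T` for tempered distributions `T` and `U`: the Fourier transform of `U` is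
`|ξ|^s` times that of `T`. As `|ξ|^s` is not smooth at the origin, the product is the limit in
`𝓢'`, as `ε → 0⁺`, of `(1 - χ(ξ/ε)) |ξ|^s` times the Fourier transform of `T`, for every smooth
compactly supported cut-off `χ` equal to `1` near the origin. (The topology of `𝓢'` is that of
pointwise convergence on Schwartz functions.) -/
def IsFracLaplacian {n : ℕ} (s : ℝ) (T U : 𝓢'(Rn n, ℂ)) : Prop :=
  ∀ χ : Rn n → ℝ, ContDiff ℝ ∞ χ → HasCompactSupport χ → (∀ᶠ ξ in 𝓝 0, χ ξ = 1) →
    Tendsto (fun ε : ℝ => TemperedDistribution.fourierMultiplierCLM ℂ (truncSymbol s χ ε) T)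
      (𝓝[>] 0) (𝓝 U)

/-- There is at most one distribution `(-Δ)^{s/2} T`. -/
theorem IsFracLaplacian.unique {n : ℕ} {s : ℝ} {T U V : 𝓢'(Rn n, ℂ)}
    (hU : IsFracLaplacian s T U) (hV : IsFracLaplacian s T V) : U = V := by
  let b : ContDiffBump (0 : Rn n) := ⟨1, 2, one_pos, one_lt_two⟩
  have hb : ∀ᶠ ξ in 𝓝 (0 : Rn n), b ξ = 1 := b.eventuallyEq_one
  exact tendsto_nhds_unique (hU b b.contDiff b.hasCompactSupport hb)
    (hV b b.contDiff b.hasCompactSupport hb)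

/-- The function `g` is `(-Δ)^{s/2} T`. -/
def IsFracLaplacianFun {n : ℕ} (s : ℝ) (T : 𝓢'(Rn n, ℂ)) (g : Rn n → ℂ) : Prop :=
  ∃ U : 𝓢'(Rn n, ℂ), IsFracLaplacian s T U ∧ IsRepresentedBy U g

end

/-!
Throughout, `T` is the distribution `f`, the function `b` is a fixed smooth bump equal to `1` on
the unit ball, and `|D|^σ` stands for `(-Δ)^{σ/2}`. The symbol of `|D|^σ` is cut into the dyadic
pieces `(b(2^{-j} ξ) - b(2^{1-j} ξ)) (2π|ξ|)^σ`, `j ∈ ℤ`, and `a_j(x)` denotes the `j`-th piece of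
`|D|^σ T` (`lpCoeff`).

*Besov bound.* A compactly supported symbol is a gaussian times another Schwartz function, so a
frequency piece at scale `R` is an average of `h_t * T` with `t = R⁻²`; hence
`|a_j| ≤ C 2^{j(σ + β)} ‖T‖` (`norm_apply_shift_fourier_le`). As `σ + β > 0`, the truncations in
the definition of `|D|^σ T` converge geometrically at low frequencies, and their limit does not
depend on the cut-off (`exists_isFracLaplacian`).

*The distribution is a continuous function.* At high frequencies the Besov bound is useless, but
`f` is smooth: the symbol of the piece at scale `R` contains `m` factors `|ξ|²`, which turn into
`R^{-2m}` times the same kind of piece of `Δ^m f`. The latter is locally bounded, uniformly in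
`R ≥ 1`, because the part of the kernel outside a ball of fixed radius is negligible in every
Schwartz seminorm (`exists_bound_of_continuous`). Thus `a_j` decays faster than any power of
`2^{-j}`, locally uniformly (`exists_decay_of_contDiff`), and `∑ a_j` converges locally uniformly
to a continuous function, which represents `|D|^σ T` (`continuous_lpSum`,
`IsFracLaplacian.isRepresentedBy`).

*Maximal function bound.* The piece of `|D|^{s₁} T` at frequency `2^j` is obtained from
`g = |D|^s T` by convolution with `2^{j(s₁ - s)}` times an `L¹`-normalised dilate of a Schwartz
kernel. The kernel has a radially decreasing integrable majorant, whose superlevel sets are balls,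
so by the layer-cake formula the piece is at most `C 2^{-j(s - s₁)} M g(x)`
(`lintegral_radialMajorant_mul_le`, `norm_apply_shift_le_hlMaximal`).

*Conclusion.* Each piece of `|D|^{s₁} T` at `x` is at most
`C min (2^{j(s₁ + β)} ‖T‖) (2^{-j(s - s₁)} M g(x))`. Summing over `j`, with the two bounds balanced
at `2^{j(s + β)} ≈ M g(x) / ‖T‖`, gives `C (M g(x))^{1 - θ} ‖T‖^θ` (`tsum_min_le`). The conventions
on `∞ · 0` cause no trouble: if `‖T‖ = 0` then all the pieces vanish, and if `‖T‖ > 0` and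
`M g(x) = ∞` the right-hand side is infinite.
-/

noncomputable section

open scoped FourierTransform LineDeriv Laplacian

/-! ### Translations, convolutions and Fourier multipliers of Schwartz functions -/

section SchwartzPairing

variable {E : Type*} [NormedAddCommGroup E] [InnerProductSpace ℝ E]

/-- The translate `y ↦ K (y - x)` of a Schwartz function. -/
abbrev shift (x : E) (K : 𝓢(E, ℂ)) : 𝓢(E, ℂ) := K.compSubConstCLM ℂ x

theorem pow_mul_iteratedFDeriv_le (k m : ℕ) (K : 𝓢(E, ℂ)) :
    ∃ C, 0 ≤ C ∧ ∀ x, (1 + ‖x‖) ^ k * ‖iteratedFDeriv ℝ m K x‖ ≤ C :=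
  ⟨2 ^ k * ((Finset.Iic (k, m)).sup fun i => SchwartzMap.seminorm ℂ i.1 i.2) K, by positivity,
    fun x => SchwartzMap.one_add_le_sup_seminorm_apply (m := (k, m)) le_rfl le_rfl K x⟩

theorem iteratedFDeriv_shift (m : ℕ) (x y : E) (K : 𝓢(E, ℂ)) :
    iteratedFDeriv ℝ m (shift x K) y = iteratedFDeriv ℝ m K (y - x) := by
  have : (shift x K : E → ℂ) = fun z => K (z - x) := rfl
  rw [this, iteratedFDeriv_comp_sub]

theorem norm_le_one_add_mul {E : Type*} [SeminormedAddCommGroup E] (x y : E) :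
    ‖y‖ ≤ (1 + ‖y - x‖) * (1 + ‖x‖) := by
  have h : ‖y‖ ≤ ‖y - x‖ + ‖x‖ := by simpa using norm_add_le (y - x) x
  nlinarith [norm_nonneg (y - x), norm_nonneg x]

/-- Seminorms of translates grow polynomially. -/
theorem shift_seminorm_le (k m : ℕ) (K : 𝓢(E, ℂ)) :
    ∃ C, 0 ≤ C ∧ ∀ x y : E,
      ‖y‖ ^ k * ‖iteratedFDeriv ℝ m (shift x K) y‖ ≤ C * (1 + ‖x‖) ^ k := by
  obtain ⟨C, hC, h⟩ := pow_mul_iteratedFDeriv_le k m K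
  refine ⟨C, hC, fun x y => ?_⟩
  rw [iteratedFDeriv_shift]
  calc ‖y‖ ^ k * ‖iteratedFDeriv ℝ m K (y - x)‖
      ≤ ((1 + ‖y - x‖) * (1 + ‖x‖)) ^ k * ‖iteratedFDeriv ℝ m K (y - x)‖ := by
        gcongr; exact norm_le_one_add_mul x y
    _ = ((1 + ‖y - x‖) ^ k * ‖iteratedFDeriv ℝ m K (y - x)‖) * (1 + ‖x‖) ^ k := by
      rw [mul_pow]; ring
    _ ≤ C * (1 + ‖x‖) ^ k := by gcongr; exact h _

theorem shift_sub_seminorm_le (k m : ℕ) (K : 𝓢(E, ℂ)) (x₀ : E) :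
    ∃ C, 0 ≤ C ∧ ∀ x y : E, ‖x - x₀‖ ≤ 1 →
      ‖y‖ ^ k * ‖iteratedFDeriv ℝ m (shift x K - shift x₀ K : 𝓢(E, ℂ)) y‖ ≤ C * ‖x - x₀‖ := by
  obtain ⟨C, hC, h⟩ := pow_mul_iteratedFDeriv_le k (m + 1) K
  refine ⟨C * (2 + ‖x₀‖) ^ k, by positivity, fun x y hx => ?_⟩
  have hd : iteratedFDeriv ℝ m (shift x K - shift x₀ K : 𝓢(E, ℂ)) y =
      iteratedFDeriv ℝ m K (y - x) - iteratedFDeriv ℝ m K (y - x₀) := by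
    have e : ((shift x K - shift x₀ K : 𝓢(E, ℂ)) : E → ℂ) =
      (shift x K : E → ℂ) - (shift x₀ K : E → ℂ) := by ext z; simp
    rw [e, iteratedFDeriv_sub_apply ((shift x K).contDiffAt m) ((shift x₀ K).contDiffAt m),
      iteratedFDeriv_shift, iteratedFDeriv_shift]
  -- the mean value theorem along the segment from `y - x₀` to `y - x`
  have hmv : ‖y‖ ^ k * ‖iteratedFDeriv ℝ m K (y - x) - iteratedFDeriv ℝ m K (y - x₀)‖ ≤
      C * (2 + ‖x₀‖) ^ k * ‖(y - x) - (y - x₀)‖ := by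
    have hsm : ContDiff ℝ ((m + 1 : ℕ) : ℕ∞) K := K.smooth _
    have key := Convex.norm_image_sub_le_of_norm_fderiv_le (𝕜 := ℝ)
      (f := fun z => (‖y‖ ^ k) • iteratedFDeriv ℝ m K z) (C := C * (2 + ‖x₀‖) ^ k)
      (s := segment ℝ (y - x₀) (y - x)) (x := y - x₀) (y := y - x)
      (fun z _ => DifferentiableAt.fun_const_smul
        ((hsm.differentiable_iteratedFDeriv (by exact_mod_cast Nat.lt_succ_self m)) z) _)
      (fun z hz => ?_) (convex_segment _ _) (left_mem_segment _ _ _) (right_mem_segment _ _ _)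
    · simpa [← smul_sub, norm_smul] using key
    · have hw : ‖(y - z) - x₀‖ ≤ 1 := by
        have hz' : z ∈ Metric.closedBall (y - x₀) 1 :=
          (convex_closedBall (y - x₀) 1).segment_subset (by simp)
            (by simpa [dist_eq_norm, norm_sub_rev] using hx) hz
        rw [mem_closedBall_iff_norm] at hz'
        rwa [show y - z - x₀ = -(z - (y - x₀)) by abel, norm_neg]
      have hw' : ‖y - z‖ ≤ 1 + ‖x₀‖ := by
        have := norm_add_le ((y - z) - x₀) x₀
        rw [sub_add_cancel] at this; linarith
      rw [fderiv_fun_const_smul ((hsm.differentiable_iteratedFDeriv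
        (by exact_mod_cast Nat.lt_succ_self m)) z), norm_smul, norm_fderiv_iteratedFDeriv]
      have hy := norm_le_one_add_mul (y - z) y
      rw [sub_sub_cancel] at hy
      calc ‖‖y‖ ^ k‖ * ‖iteratedFDeriv ℝ (m + 1) K z‖
          = ‖y‖ ^ k * ‖iteratedFDeriv ℝ (m + 1) K z‖ := by simp
        _ ≤ ((1 + ‖z‖) * (2 + ‖x₀‖)) ^ k * ‖iteratedFDeriv ℝ (m + 1) K z‖ := by
          gcongr
          exact hy.trans (mul_le_mul_of_nonneg_left (by linarith) (by positivity))
        _ = ((1 + ‖z‖) ^ k * ‖iteratedFDeriv ℝ (m + 1) K z‖) * (2 + ‖x₀‖) ^ k := by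
          rw [mul_pow]; ring
        _ ≤ C * (2 + ‖x₀‖) ^ k := by gcongr; exact h _
  rw [hd]
  refine hmv.trans (le_of_eq ?_)
  congr 1
  rw [← norm_neg]; congr 1; abel

theorem continuous_shift (K : 𝓢(E, ℂ)) : Continuous fun x : E => shift x K := by
  rw [continuous_iff_continuousAt]
  intro x₀
  refine ((schwartz_withSeminorms ℂ E ℂ).tendsto_nhds _ _).2 fun i ε hε => ?_
  obtain ⟨C, hC, h⟩ := shift_sub_seminorm_le i.1 i.2 K x₀
  have ht : Tendsto (fun x : E => C * ‖x - x₀‖) (𝓝 x₀) (𝓝 0) := by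
    have : Continuous fun x : E => C * ‖x - x₀‖ := by fun_prop
    simpa using this.tendsto x₀
  filter_upwards [ht.eventually (gt_mem_nhds hε), Metric.closedBall_mem_nhds x₀ one_pos]
    with x hx hx1
  refine lt_of_le_of_lt ?_ hx
  exact SchwartzMap.seminorm_le_bound ℂ i.1 i.2 _ (by positivity)
    fun y => h x y (by simpa [dist_eq_norm] using hx1)

/-- A tempered distribution is bounded by finitely many Schwartz seminorms. -/
theorem temperedDistribution_bound (T : 𝓢'(E, ℂ)) :
    ∃ N : ℕ, ∃ C : ℝ, 0 ≤ C ∧ ∀ (φ : 𝓢(E, ℂ)) (M : ℝ), 0 ≤ M →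
      (∀ k ≤ N, ∀ m ≤ N, ∀ x, ‖x‖ ^ k * ‖iteratedFDeriv ℝ m φ x‖ ≤ M) → ‖T φ‖ ≤ C * M := by
  obtain ⟨s, C, -, h⟩ := Seminorm.bound_of_continuous (schwartz_withSeminorms ℂ E ℂ)
    ((normSeminorm ℂ ℂ).comp (T : 𝓢(E, ℂ) →ₗ[ℂ] ℂ)) (continuous_norm.comp T.continuous)
  refine ⟨s.sup fun i => max i.1 i.2, C, C.2, fun φ M hM hb => ?_⟩
  refine (h φ).trans ?_
  change C * (s.sup (schwartzSeminormFamily ℂ E ℂ)) φ ≤ C * M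
  gcongr
  refine Seminorm.finset_sup_apply_le hM fun i hi => ?_
  have hi' : max i.1 i.2 ≤ s.sup fun i => max i.1 i.2 :=
    Finset.le_sup (f := fun i : ℕ × ℕ => max i.1 i.2) hi
  exact SchwartzMap.seminorm_le_bound ℂ i.1 i.2 _ hM
    (hb i.1 ((le_max_left _ _).trans hi') i.2 ((le_max_right _ _).trans hi'))

theorem continuous_apply_shift (T : 𝓢'(E, ℂ)) (K : 𝓢(E, ℂ)) :
    Continuous fun x : E => T (shift x K) :=
  T.continuous.comp (continuous_shift K)

variable (E) in
/-- The Banach space of bounded continuous functions on `E` whose values are `m`-linear forms,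
as a type of its own that carries only the three instances below. -/
def MultilinearBCF (m : ℕ) : Type _ := BoundedContinuousFunction E (E [×m]→L[ℝ] ℂ)

instance (m : ℕ) : NormedAddCommGroup (MultilinearBCF E m) :=
  inferInstanceAs (NormedAddCommGroup (BoundedContinuousFunction E (E [×m]→L[ℝ] ℂ)))

instance (m : ℕ) : NormedSpace ℂ (MultilinearBCF E m) :=
  inferInstanceAs (NormedSpace ℂ (BoundedContinuousFunction E (E [×m]→L[ℝ] ℂ)))

instance (m : ℕ) : CompleteSpace (MultilinearBCF E m) :=
  inferInstanceAs (CompleteSpace (BoundedContinuousFunction E (E [×m]→L[ℝ] ℂ)))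

/-- Evaluation of an element of `MultilinearBCF E m` at a point and at `m` vectors. -/
def MultilinearBCF.evalCLM (m : ℕ) (y : E) (v : Fin m → E) : MultilinearBCF E m →L[ℝ] ℂ :=
  (ContinuousMultilinearMap.apply ℝ (fun _ : Fin m => E) ℂ v) ∘L
    (BoundedContinuousFunction.evalCLM ℝ y :
      BoundedContinuousFunction E (E [×m]→L[ℝ] ℂ) →L[ℝ] (E [×m]→L[ℝ] ℂ))

/-- The weighted derivative `x ↦ ‖x‖ ^ k • D^m φ x` of a Schwartz function, as a bounded
continuous function; its norm is a Schwartz seminorm of `φ`. -/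
def weightedDeriv (k m : ℕ) : 𝓢(E, ℂ) →ₗ[ℂ] MultilinearBCF E m where
  toFun φ := BoundedContinuousFunction.ofNormedAddCommGroup
    (fun x => (‖x‖ ^ k : ℝ) • iteratedFDeriv ℝ m φ x)
    ((continuous_norm.pow k).smul ((φ.smooth m).continuous_iteratedFDeriv le_rfl))
    (SchwartzMap.seminorm ℂ k m φ)
    (fun x => by
      rw [norm_smul, Real.norm_of_nonneg (by positivity)]
      exact SchwartzMap.le_seminorm ℂ k m φ x)
  map_add' φ ψ := by
    refine BoundedContinuousFunction.ext fun x => ?_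
    change (‖x‖ ^ k : ℝ) • iteratedFDeriv ℝ m ((φ : E → ℂ) + (ψ : E → ℂ)) x = _
    rw [iteratedFDeriv_add_apply (φ.contDiffAt m) (ψ.contDiffAt m), smul_add]
    rfl
  map_smul' c φ := by
    refine BoundedContinuousFunction.ext fun x => ?_
    change (‖x‖ ^ k : ℝ) • iteratedFDeriv ℝ m (c • (φ : E → ℂ)) x = _
    rw [iteratedFDeriv_const_smul_apply (φ.contDiffAt m), smul_comm]
    rfl

theorem weightedDeriv_norm_le (k m : ℕ) (φ : 𝓢(E, ℂ)) {M : ℝ} (hM : 0 ≤ M)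
    (h : ∀ x, ‖x‖ ^ k * ‖iteratedFDeriv ℝ m φ x‖ ≤ M) : ‖weightedDeriv k m φ‖ ≤ M := by
  refine BoundedContinuousFunction.norm_ofNormedAddCommGroup_le _ hM fun x => ?_
  rw [norm_smul, Real.norm_of_nonneg (by positivity)]
  exact h x

theorem le_weightedDeriv_norm (k m : ℕ) (φ : 𝓢(E, ℂ)) (x : E) :
    ‖x‖ ^ k * ‖iteratedFDeriv ℝ m φ x‖ ≤ ‖weightedDeriv k m φ‖ := by
  refine le_trans (le_of_eq ?_) (BoundedContinuousFunction.norm_coe_le_norm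
    (weightedDeriv k m φ : BoundedContinuousFunction E (E [×m]→L[ℝ] ℂ)) x)
  change _ = ‖(‖x‖ ^ k : ℝ) • iteratedFDeriv ℝ m φ x‖
  rw [norm_smul, Real.norm_of_nonneg (by positivity)]

theorem continuous_weightedDeriv (k m : ℕ) :
    Continuous (weightedDeriv (E := E) k m) := by
  refine WithSeminorms.continuous_normedSpace_rng _ (schwartz_withSeminorms ℂ E ℂ) _
    ⟨{(k, m)}, 1, fun φ => ?_⟩
  simp only [Finset.sup_singleton, one_smul, Seminorm.comp_apply, coe_normSeminorm]
  exact weightedDeriv_norm_le k m φ (apply_nonneg _ _) (SchwartzMap.le_seminorm ℂ k m φ)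

/-- Every tempered distribution factors through a Banach space of weighted derivatives (by the
Hahn–Banach theorem). This makes the Bochner integral available, for which there is no theory in the
Schwartz space itself. -/
theorem exists_factorization (T : 𝓢'(E, ℂ)) :
    ∃ N : ℕ, ∃ ℓ : (∀ i : Fin (N + 1) × Fin (N + 1), MultilinearBCF E (i.2 : ℕ)) →L[ℂ] ℂ,
      ∀ φ, T φ = ℓ (fun i => weightedDeriv i.1 i.2 φ) := by
  obtain ⟨N, C, hC, hT⟩ := temperedDistribution_bound T
  refine ⟨N, ?_⟩
  let A : 𝓢(E, ℂ) →ₗ[ℂ] (∀ i : Fin (N + 1) × Fin (N + 1), MultilinearBCF E (i.2 : ℕ)) :=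
    LinearMap.pi fun i => weightedDeriv i.1 i.2
  have hA : Function.Injective A := by
    rw [← LinearMap.ker_eq_bot, LinearMap.ker_eq_bot']
    intro φ hφ
    ext x
    have h0 : weightedDeriv 0 0 φ = 0 := congrFun hφ (0, 0)
    have h1 := le_weightedDeriv_norm 0 0 φ x
    rw [h0, pow_zero, one_mul, norm_iteratedFDeriv_zero, norm_zero] at h1
    simpa using h1
  let e := LinearEquiv.ofInjective A hA
  have hb : ∀ φ, ‖T φ‖ ≤ C * ‖A φ‖ := fun φ => by
    refine hT φ _ (norm_nonneg _) fun k hk m hm x => ?_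
    have h1 : ‖weightedDeriv k m φ‖ ≤ ‖A φ‖ :=
      norm_le_pi_norm (A φ) (⟨k, Nat.lt_succ_of_le hk⟩, ⟨m, Nat.lt_succ_of_le hm⟩)
    exact (le_weightedDeriv_norm k m φ x).trans h1
  let f : LinearMap.range A →L[ℂ] ℂ :=
    LinearMap.mkContinuous ((T : 𝓢(E, ℂ) →ₗ[ℂ] ℂ) ∘ₗ e.symm.toLinearMap) C fun v => by
      have h := hb (e.symm v)
      have h2 : A (e.symm v) = v := congrArg Subtype.val (e.apply_symm_apply v)
      rw [h2] at h
      exact h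
  obtain ⟨ℓ, hℓ, -⟩ := exists_extension_norm_eq _ f
  refine ⟨ℓ, fun φ => ?_⟩
  have := hℓ (e φ)
  change ℓ (A φ) = T (e.symm (e φ)) at this
  rw [LinearEquiv.symm_apply_apply] at this
  exact this.symm

variable [FiniteDimensional ℝ E] [MeasurableSpace E] [BorelSpace E]

/-- The convolution `φ * K` of two Schwartz functions. -/
abbrev conv (φ K : 𝓢(E, ℂ)) : 𝓢(E, ℂ) :=
  SchwartzMap.convolution (ContinuousLinearMap.mul ℂ ℂ) φ K

theorem conv_apply (φ K : 𝓢(E, ℂ)) (y : E) : conv φ K y = ∫ x, φ x * K (y - x) := by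
  rw [conv, SchwartzMap.convolution_apply, convolution_def]
  rfl

theorem conv_comm (φ K : 𝓢(E, ℂ)) : conv φ K = conv K φ := by
  ext y
  rw [conv_apply, conv_apply, ← integral_sub_left_eq_self _ _ y]
  simp [mul_comm]

theorem lineDeriv_conv (v : E) (φ K : 𝓢(E, ℂ)) : ∂_{v} (conv φ K) = conv φ (∂_{v} K) := by
  have hv : (fun x : E => inner ℝ x v).HasTemperateGrowth := by fun_prop
  have h : ∀ φ K : 𝓢(E, ℂ), conv φ K =
    𝓕⁻ (SchwartzMap.pairing (ContinuousLinearMap.mul ℂ ℂ) (𝓕 φ) (𝓕 K)) := fun _ _ => rfl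
  rw [h, h, SchwartzMap.lineDerivOp_fourierInv_eq, SchwartzMap.fourier_lineDerivOp_eq]
  congr 1
  ext x
  simp [SchwartzMap.smulLeftCLM_apply_apply hv, SchwartzMap.pairing_apply_apply]
  ring

theorem iteratedLineDeriv_conv {m : ℕ} (v : Fin m → E) (φ K : 𝓢(E, ℂ)) :
    ∂^{v} (conv φ K) = conv φ (∂^{v} K) := by
  induction m with
  | zero => simp
  | succ m ih => simp only [LineDeriv.iteratedLineDerivOp_succ_left, ih, lineDeriv_conv]

/-- The exchange of a tempered distribution with the integral defining a convolution: under the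
factorization of `T` the convolution is a Bochner integral of translates. -/
theorem apply_conv (T : 𝓢'(E, ℂ)) (φ K : 𝓢(E, ℂ)) :
    T (conv φ K) = ∫ x, φ x * T (shift x K) := by
  obtain ⟨N, ℓ, hℓ⟩ := exists_factorization T
  let A : 𝓢(E, ℂ) → (∀ i : Fin (N + 1) × Fin (N + 1), MultilinearBCF E (i.2 : ℕ)) :=
    fun ψ i => weightedDeriv i.1 i.2 ψ
  have hAc : Continuous A := continuous_pi fun i => continuous_weightedDeriv _ _
  have hcont : Continuous fun x => φ x • A (shift x K) :=
    φ.continuous.smul (hAc.comp (continuous_shift K))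
  -- polynomial growth of `x ↦ A (shift x K)`
  obtain ⟨C, hC, hb⟩ : ∃ C, 0 ≤ C ∧ ∀ x, ‖A (shift x K)‖ ≤ C * (1 + ‖x‖) ^ N := by
    choose C hC hb using fun i : Fin (N + 1) × Fin (N + 1) =>
      shift_seminorm_le (i.1 : ℕ) (i.2 : ℕ) K
    have hS : 0 ≤ ∑ i, C i := Finset.sum_nonneg fun i _ => hC i
    refine ⟨∑ i, C i, hS, fun x => ?_⟩
    rw [pi_norm_le_iff_of_nonneg (by positivity)]
    intro i
    refine weightedDeriv_norm_le _ _ _ (by positivity) fun y => (hb i x y).trans ?_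
    have h1 : (1 + ‖x‖) ^ (i.1 : ℕ) ≤ (1 + ‖x‖) ^ N :=
      pow_le_pow_right₀ (by linarith [norm_nonneg x]) (Nat.lt_succ_iff.1 i.1.2)
    have h2 : C i ≤ ∑ i, C i := Finset.single_le_sum (fun i _ => hC i) (Finset.mem_univ i)
    gcongr
  have hint : Integrable fun x => φ x • A (shift x K) := by
    have hg : Integrable fun x : E => C * 2 ^ N * (‖φ x‖ + ‖x‖ ^ N * ‖φ x‖) :=
      (φ.integrable.norm.add (φ.integrable_pow_mul volume N)).const_mul _
    refine hg.mono' hcont.aestronglyMeasurable (ae_of_all _ fun x => ?_)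
    rw [norm_smul]
    have h2 : (1 + ‖x‖) ^ N ≤ 2 ^ N * (1 + ‖x‖ ^ N) := by
      have h := add_pow_le (zero_le_one) (norm_nonneg x) N
      rw [one_pow] at h
      refine h.trans ?_
      gcongr
      · norm_num
      · omega
    calc ‖φ x‖ * ‖A (shift x K)‖ ≤ ‖φ x‖ * (C * (2 ^ N * (1 + ‖x‖ ^ N))) := by
          gcongr; exact (hb x).trans (by gcongr)
      _ = _ := by ring
  have hval : A (conv φ K) = ∫ x, φ x • A (shift x K) := by
    funext i
    refine BoundedContinuousFunction.ext fun y => ContinuousMultilinearMap.ext fun v => ?_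
    -- evaluation at `i`, `y` and `v` is a continuous linear functional
    let L : (∀ i : Fin (N + 1) × Fin (N + 1), MultilinearBCF E (i.2 : ℕ)) →L[ℝ] ℂ :=
      (MultilinearBCF.evalCLM i.2 y v) ∘L (ContinuousLinearMap.proj i)
    have hL := L.integral_comp_comm hint
    have hA : ∀ ψ, L (A ψ) = (‖y‖ ^ (i.1 : ℕ) : ℝ) • (∂^{v} ψ) y := fun ψ => by
      rw [SchwartzMap.iteratedLineDerivOp_eq_iteratedFDeriv]; rfl
    have hA' : ∀ x, L (φ x • A (shift x K)) =
        (‖y‖ ^ (i.1 : ℕ) : ℝ) • (φ x * (∂^{v} K) (y - x)) := fun x => by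
      have : L (φ x • A (shift x K)) = φ x • L (A (shift x K)) := rfl
      rw [this, hA, SchwartzMap.iteratedLineDerivOp_eq_iteratedFDeriv, iteratedFDeriv_shift,
        SchwartzMap.iteratedLineDerivOp_eq_iteratedFDeriv, smul_comm]
      rfl
    change L (A (conv φ K)) = L _
    rw [← hL, hA, iteratedLineDeriv_conv, conv_apply]
    simp only [hA']
    rw [integral_smul]
  rw [hℓ]
  change ℓ (A (conv φ K)) = _
  rw [hval, ← ContinuousLinearMap.integral_comp_comm ℓ hint]
  congr 1
  funext x
  rw [map_smul, hℓ (shift x K), smul_eq_mul]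

/-- The Fourier multiplier with a Schwartz symbol is a convolution. -/
theorem fourier_smul_fourierInv (m φ : 𝓢(E, ℂ)) :
    𝓕 (SchwartzMap.smulLeftCLM ℂ (m : E → ℂ) (𝓕⁻ φ)) = conv φ (𝓕 m) := by
  have h : ∀ (ψ : 𝓢(E, ℂ)) (y : E), 𝓕⁻ ψ y = 𝓕 ψ (-y) := fun ψ y => by
    rw [SchwartzMap.fourierInv_coe, SchwartzMap.fourier_coe, Real.fourierInv_eq_fourier_neg]
  have h' : SchwartzMap.smulLeftCLM ℂ (m : E → ℂ) (𝓕⁻ φ) =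
      SchwartzMap.pairing (ContinuousLinearMap.mul ℂ ℂ) (𝓕 (𝓕⁻ m)) (𝓕⁻ φ) := by
    ext x
    simp [SchwartzMap.smulLeftCLM_apply_apply m.hasTemperateGrowth]
  have h2 : 𝓕⁻ (SchwartzMap.smulLeftCLM ℂ (m : E → ℂ) (𝓕⁻ φ)) =
      conv (𝓕⁻ (𝓕⁻ φ)) (𝓕⁻ m) := by
    rw [conv_comm, h']
    simp [conv, SchwartzMap.convolution]
  ext y
  rw [← neg_neg y, ← h, h2, conv_apply, conv_apply, neg_neg, ← integral_neg_eq_self]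
  congr 1
  funext x
  rw [h, h, neg_neg, FourierTransform.fourier_fourierInv_eq]
  congr 2
  abel

theorem shift_conv (x : E) (φ K : 𝓢(E, ℂ)) : shift x (conv φ K) = conv (shift x φ) K := by
  ext y
  change conv φ K (y - x) = _
  rw [conv_apply, conv_apply, ← integral_sub_right_eq_self _ x]
  congr 1
  funext z
  simp [shift, sub_sub_sub_cancel_right]

end SchwartzPairing

/-! ### Dilations and smooth cut-offs -/

section Dilation

variable {E : Type*} [NormedAddCommGroup E] [InnerProductSpace ℝ E]

/-- The dilate `x ↦ φ (R • x)` of a Schwartz function. -/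
def dil {R : ℝ} (hR : 0 < R) (φ : 𝓢(E, ℂ)) : 𝓢(E, ℂ) :=
  SchwartzMap.compCLMOfContinuousLinearEquiv ℂ
    (ContinuousLinearEquiv.smulLeft (R₁ := ℝ) (M₁ := E) (Units.mk0 R hR.ne')) φ

theorem dil_apply {R : ℝ} (hR : 0 < R) (φ : 𝓢(E, ℂ)) (x : E) : dil hR φ x = φ (R • x) := rfl

theorem norm_iteratedFDeriv_dil {R : ℝ} (hR : 0 < R) (m : ℕ) (φ : 𝓢(E, ℂ)) (x : E) :
    ‖iteratedFDeriv ℝ m (dil hR φ) x‖ = R ^ m * ‖iteratedFDeriv ℝ m φ (R • x)‖ := by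
  have h : (dil hR φ : E → ℂ) = fun x => φ (R • x) := rfl
  rw [h, iteratedFDeriv_comp_const_smul (i := m) R (φ.smooth m), norm_smul,
    Real.norm_of_nonneg (by positivity)]

variable [FiniteDimensional ℝ E] [MeasurableSpace E] [BorelSpace E]

/-- The Fourier transform of the dilated symbol `m (ξ / R)`. -/
theorem fourier_dil_inv {R : ℝ} (hR : 0 < R) (m : 𝓢(E, ℂ)) (y : E) :
    𝓕 (dil (inv_pos.2 hR) m) y = (R : ℂ) ^ Module.finrank ℝ E * 𝓕 m (R • y) := by
  rw [SchwartzMap.fourier_coe, SchwartzMap.fourier_coe, Real.fourier_eq, Real.fourier_eq]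
  have h := Measure.integral_comp_inv_smul (μ := (volume : Measure E))
    (fun v => Real.fourierChar (-inner ℝ v (R • y)) • m v) R
  rw [abs_of_pos (by positivity)] at h
  have h2 : ∀ v : E, Real.fourierChar (-inner ℝ (R⁻¹ • v) (R • y)) • m (R⁻¹ • v) =
      Real.fourierChar (-inner ℝ v y) • dil (inv_pos.2 hR) m v := fun v => by
    rw [real_inner_smul_left, real_inner_smul_right, inv_mul_cancel_left₀ hR.ne', dil_apply]
  simp only [h2] at h
  rw [h, Complex.real_smul]
  push_cast
  rfl

theorem integral_norm_fourier_dil_inv {R : ℝ} (hR : 0 < R) (m : 𝓢(E, ℂ)) :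
    ∫ y, ‖𝓕 (dil (inv_pos.2 hR) m) y‖ = ∫ y, ‖𝓕 m y‖ := by
  simp only [fourier_dil_inv hR, norm_mul, norm_pow, Complex.norm_real, Real.norm_of_nonneg hR.le]
  rw [integral_const_mul, Measure.integral_comp_smul volume (fun y => ‖𝓕 m y‖) R,
    abs_of_pos (by positivity), smul_eq_mul, ← mul_assoc, mul_inv_cancel₀ (by positivity), one_mul]

end Dilation

section Cutoff

variable {E : Type*} [NormedAddCommGroup E] [InnerProductSpace ℝ E] [FiniteDimensional ℝ E]

variable (E) in
/-- A fixed smooth bump function on `E`, equal to `1` on the unit ball and supported in the ball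
of radius `2`. -/
def bump : ContDiffBump (0 : E) := ⟨1, 2, one_pos, one_lt_two⟩

theorem bump_eq_one {x : E} (hx : ‖x‖ ≤ 1) : bump E x = 1 :=
  (bump E).one_of_mem_closedBall (by simpa [bump] using hx)

theorem bump_eq_zero {x : E} (hx : 2 ≤ ‖x‖) : bump E x = 0 :=
  (bump E).zero_of_le_dist (by simpa [bump] using hx)

variable (E) in
/-- The bump function as a complex Schwartz function. -/
def bumpS : 𝓢(E, ℂ) :=
  ((bump E).hasCompactSupport.comp_left (g := Complex.ofReal) (by simp)).toSchwartzMap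
    (Complex.ofRealCLM.contDiff.comp (bump E).contDiff)

theorem bumpS_apply (x : E) : bumpS E x = ((bump E x : ℝ) : ℂ) := rfl

theorem hasCompactSupport_dil_bumpS {R : ℝ} (hR : 0 < R) :
    HasCompactSupport (dil hR (bumpS E)) := by
  refine HasCompactSupport.of_support_subset_isCompact (isCompact_closedBall (0 : E) (2 * R⁻¹))
    fun x hx => ?_
  rw [mem_closedBall_zero_iff]
  by_contra h
  push Not at h
  refine hx ?_
  rw [dil_apply, bumpS_apply, bump_eq_zero, Complex.ofReal_zero]
  rw [norm_smul, Real.norm_of_nonneg hR.le]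
  calc 2 = R * (2 * R⁻¹) := by field_simp
    _ ≤ R * ‖x‖ := by gcongr

/-- The part `b (x / R) φ(x)` of a Schwartz function near the ball of radius `R`. -/
def head {R : ℝ} (hR : 0 < R) (φ : 𝓢(E, ℂ)) : 𝓢(E, ℂ) :=
  SchwartzMap.smulLeftCLM ℂ (dil (inv_pos.2 hR) (bumpS E)) φ

theorem head_apply {R : ℝ} (hR : 0 < R) (φ : 𝓢(E, ℂ)) (x : E) :
    head hR φ x = ((bump E (R⁻¹ • x) : ℝ) : ℂ) * φ x := by
  rw [head, SchwartzMap.smulLeftCLM_apply_apply (SchwartzMap.hasTemperateGrowth _), dil_apply,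
    bumpS_apply, smul_eq_mul]

theorem norm_head_le {R : ℝ} (hR : 0 < R) (φ : 𝓢(E, ℂ)) (x : E) : ‖head hR φ x‖ ≤ ‖φ x‖ := by
  rw [head_apply, norm_mul, Complex.norm_real, Real.norm_of_nonneg (bump E).nonneg]
  exact mul_le_of_le_one_left (norm_nonneg _) (bump E).le_one

theorem head_eq_zero {R : ℝ} (hR : 0 < R) (φ : 𝓢(E, ℂ)) {x : E} (hx : 2 * R ≤ ‖x‖) :
    head hR φ x = 0 := by
  rw [head_apply, bump_eq_zero, Complex.ofReal_zero, zero_mul]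
  rw [norm_smul, norm_inv, Real.norm_of_nonneg hR.le, ← div_eq_inv_mul, le_div_iff₀ hR]
  exact hx

theorem head_eq_self {R : ℝ} (hR : 0 < R) (φ : 𝓢(E, ℂ)) {x : E} (hx : ‖x‖ ≤ R) :
    head hR φ x = φ x := by
  rw [head_apply, bump_eq_one, Complex.ofReal_one, one_mul]
  rw [norm_smul, norm_inv, Real.norm_of_nonneg hR.le, ← div_eq_inv_mul, div_le_one hR]
  exact hx

theorem hasCompactSupport_head {R : ℝ} (hR : 0 < R) (φ : 𝓢(E, ℂ)) :
    HasCompactSupport (head hR φ) := by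
  refine HasCompactSupport.of_support_subset_isCompact (isCompact_closedBall (0 : E) (2 * R))
    fun x hx => ?_
  rw [mem_closedBall_zero_iff]
  by_contra h
  exact hx (head_eq_zero hR φ (not_le.1 h).le)

/-- The tail of a Schwartz function outside the ball of radius `R` is `O(R ^ (-N))` in every
Schwartz seminorm. -/
theorem tail_decay (k m N : ℕ) (φ : 𝓢(E, ℂ)) :
    ∃ C, 0 ≤ C ∧ ∀ (R : ℝ) (hR : 0 < R), 1 ≤ R → ∀ x,
      R ^ N * (‖x‖ ^ k * ‖iteratedFDeriv ℝ m (φ - head hR φ : 𝓢(E, ℂ)) x‖) ≤ C := by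
  let p (i j : ℕ) (ψ : 𝓢(E, ℂ)) : ℝ := SchwartzMap.seminorm ℂ i j ψ
  have hp : ∀ i j ψ, 0 ≤ p i j ψ := fun i j ψ => apply_nonneg _ _
  refine ⟨p (k + N) m φ +
    ∑ i ∈ Finset.range (m + 1), (m.choose i) * p 0 i (bumpS E) * p (k + N) (m - i) φ,
    add_nonneg (hp _ _ _) (Finset.sum_nonneg fun i _ =>
      mul_nonneg (mul_nonneg (by positivity) (hp _ _ _)) (hp _ _ _)), fun R hR hR1 x => ?_⟩
  rcases lt_or_ge ‖x‖ R with hx | hx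
  · -- inside the ball the tail vanishes identically
    have h0 : (φ - head hR φ : 𝓢(E, ℂ)) =ᶠ[𝓝 x] fun _ => (0 : ℂ) := by
      filter_upwards [continuous_norm.continuousAt.eventually (gt_mem_nhds hx)] with y hy
      change φ y - head hR φ y = 0
      rw [head_eq_self hR φ hy.le, sub_self]
    have h1 : iteratedFDeriv ℝ m (φ - head hR φ : 𝓢(E, ℂ)) x = 0 := by
      rw [(h0.iteratedFDeriv ℝ m).eq_of_nhds]
      simp
    rw [h1, norm_zero, mul_zero, mul_zero]
    exact add_nonneg (hp _ _ _) (Finset.sum_nonneg fun i _ =>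
      mul_nonneg (mul_nonneg (by positivity) (hp _ _ _)) (hp _ _ _))
  · have h1 : R ^ N * ‖x‖ ^ k ≤ ‖x‖ ^ (k + N) := by
      rw [pow_add, mul_comm]; gcongr
    have h2 : ‖iteratedFDeriv ℝ m (φ - head hR φ : 𝓢(E, ℂ)) x‖ ≤ ‖iteratedFDeriv ℝ m φ x‖ +
        ∑ i ∈ Finset.range (m + 1), (m.choose i) * p 0 i (bumpS E) *
          ‖iteratedFDeriv ℝ (m - i) φ x‖ := by
      have e : ((φ - head hR φ : 𝓢(E, ℂ)) : E → ℂ) = (φ : E → ℂ) -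
        (fun x => dil (inv_pos.2 hR) (bumpS E) x * φ x) := by
        ext y
        change φ y - head hR φ y = φ y - _
        rw [head_apply]; rfl
      have hsm : ContDiff ℝ m (fun x => dil (inv_pos.2 hR) (bumpS E) x * φ x) :=
        ((dil (inv_pos.2 hR) (bumpS E)).smooth m).mul (φ.smooth m)
      rw [e, iteratedFDeriv_sub_apply (φ.contDiffAt m) hsm.contDiffAt]
      refine (norm_sub_le _ _).trans ?_
      gcongr
      refine (norm_iteratedFDeriv_mul_le ((dil (inv_pos.2 hR) (bumpS E)).smooth m) (φ.smooth m)
        x le_rfl).trans ?_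
      gcongr with i hi
      rw [norm_iteratedFDeriv_dil]
      refine (mul_le_of_le_one_left (norm_nonneg _) ?_).trans
        (SchwartzMap.norm_iteratedFDeriv_le_seminorm ℂ _ i _)
      exact pow_le_one₀ (by positivity) (inv_le_one_of_one_le₀ hR1)
    calc R ^ N * (‖x‖ ^ k * ‖iteratedFDeriv ℝ m (φ - head hR φ : 𝓢(E, ℂ)) x‖)
        = R ^ N * ‖x‖ ^ k * ‖iteratedFDeriv ℝ m (φ - head hR φ : 𝓢(E, ℂ)) x‖ := by ring
      _ ≤ ‖x‖ ^ (k + N) * (‖iteratedFDeriv ℝ m φ x‖ + ∑ i ∈ Finset.range (m + 1),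
            (m.choose i) * p 0 i (bumpS E) * ‖iteratedFDeriv ℝ (m - i) φ x‖) := by gcongr
      _ = ‖x‖ ^ (k + N) * ‖iteratedFDeriv ℝ m φ x‖ + ∑ i ∈ Finset.range (m + 1),
            (m.choose i) * p 0 i (bumpS E) *
              (‖x‖ ^ (k + N) * ‖iteratedFDeriv ℝ (m - i) φ x‖) := by
          rw [mul_add, Finset.mul_sum]
          congr 1
          exact Finset.sum_congr rfl fun i _ => by ring
      _ ≤ _ := by
          gcongr with i hi
          · exact SchwartzMap.le_seminorm ℂ _ _ _ _
          · exact SchwartzMap.le_seminorm ℂ _ _ _ _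

/-- The cut-off functions `b (x / R) φ` tend to `φ` when tested against a distribution. -/
theorem tendsto_apply_head (T : 𝓢'(E, ℂ)) (φ : 𝓢(E, ℂ)) {u : ℕ → ℝ} (hu : ∀ j, 0 < u j)
    (hlim : Tendsto u atTop atTop) :
    Tendsto (fun j => T (head (hu j) φ)) atTop (𝓝 (T φ)) := by
  obtain ⟨N, C, hC, hT⟩ := temperedDistribution_bound T
  choose B hB hb using fun i : ℕ × ℕ => tail_decay i.1 i.2 1 φ
  set S := ∑ i ∈ Finset.range (N + 1) ×ˢ Finset.range (N + 1), B i with hS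
  have hS0 : 0 ≤ S := Finset.sum_nonneg fun i _ => hB i
  have key : ∀ᶠ j in atTop, ‖T (head (hu j) φ) - T φ‖ ≤ C * (S / u j) := by
    filter_upwards [hlim.eventually_ge_atTop 1] with j hj
    rw [norm_sub_rev, ← map_sub]
    refine hT _ _ (div_nonneg hS0 (hu j).le) fun k hk m hm x => ?_
    rw [le_div_iff₀ (hu j), mul_comm]
    have h := hb (k, m) (u j) (hu j) hj x
    rw [pow_one] at h
    refine h.trans (Finset.single_le_sum (f := B) (fun i _ => hB i) ?_)
    simp only [Finset.mem_product, Finset.mem_range]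
    omega
  rw [tendsto_iff_norm_sub_tendsto_zero]
  refine squeeze_zero' (Eventually.of_forall fun _ => norm_nonneg _) key ?_
  simpa using (tendsto_const_nhds.div_atTop hlim).const_mul C

end Cutoff

/-! ### Frequency pieces of a distribution in the Besov space -/

section HeatKernel

variable {n : ℕ}

theorem fourierInv_heatKernel {t : ℝ} (ht : 0 < t) (ξ : Rn n) :
    𝓕⁻ (heatKernel n t ht) ξ = (Real.exp (-(4 * Real.pi ^ 2 * t * ‖ξ‖ ^ 2)) : ℂ) := by
  have hb : 0 < ((1 / (4 * t) : ℝ) : ℂ).re := by rw [Complex.ofReal_re]; positivity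
  have hfun : (heatKernel n t ht : Rn n → ℂ) = ((4 * Real.pi * t) ^ (-(n : ℝ) / 2) : ℝ) •
      fun v : Rn n => Complex.exp (-((1 / (4 * t) : ℝ) : ℂ) * (‖v‖ : ℂ) ^ 2) := by
    funext v
    rw [heatKernel_apply, heatFun, Pi.smul_apply, Complex.real_smul]
    push_cast
    congr 2
    ring
  have hF : ∀ (c : ℝ) (f : Rn n → ℂ) (w : Rn n), 𝓕 (c • f) w = c • 𝓕 f w := fun c f w => by
    rw [Real.fourier_eq, Real.fourier_eq, ← integral_smul]
    congr 1
    funext v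
    rw [Pi.smul_apply, smul_comm]
  rw [SchwartzMap.fourierInv_coe, Real.fourierInv_eq_fourier_neg, hfun, hF,
    fourier_gaussian_innerProductSpace hb, norm_neg, finrank_euclideanSpace_fin]
  have h1 : ((Real.pi : ℂ) / ((1 / (4 * t) : ℝ) : ℂ)) ^ ((n : ℂ) / 2) =
      (((4 * Real.pi * t) ^ ((n : ℝ) / 2) : ℝ) : ℂ) := by
    rw [Complex.ofReal_cpow (by positivity)]
    push_cast
    congr 1
    field_simp
  have h2 : -(Real.pi : ℂ) ^ 2 * (‖ξ‖ : ℂ) ^ 2 / ((1 / (4 * t) : ℝ) : ℂ) =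
      ((-(4 * Real.pi ^ 2 * t * ‖ξ‖ ^ 2) : ℝ) : ℂ) := by
    push_cast
    field_simp
  rw [h1, h2, ← Complex.ofReal_exp, Complex.real_smul, ← mul_assoc, ← Complex.ofReal_mul, neg_div,
    ← Real.rpow_add (by positivity), neg_add_cancel, Real.rpow_zero, Complex.ofReal_one, one_mul]

theorem norm_heatConv_ae_le {β : ℝ} {T : 𝓢'(Rn n, ℂ)} (hT : besovNorm β T < ⊤) {t : ℝ}
    (ht : 0 < t) :
    ∀ᵐ x, ‖heatConv T t ht x‖ ≤ t ^ (-(β / 2)) * (besovNorm β T).toReal := by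
  have h1 : ENNReal.ofReal (t ^ (β / 2)) * eLpNorm (heatConv T t ht) ⊤ volume ≤ besovNorm β T :=
    le_iSup₂_of_le (f := fun (t : ℝ) (ht : 0 < t) =>
      ENNReal.ofReal (t ^ (β / 2)) * eLpNorm (heatConv T t ht) ⊤ volume) t ht le_rfl
  have hpos : 0 < t ^ (β / 2) := by positivity
  have h2 : eLpNorm (heatConv T t ht) ⊤ volume ≤
      ENNReal.ofReal (t ^ (-(β / 2)) * (besovNorm β T).toReal) := by
    rw [ENNReal.ofReal_mul (by positivity), ENNReal.ofReal_toReal hT.ne, Real.rpow_neg ht.le,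
      ENNReal.ofReal_inv_of_pos hpos, ← ENNReal.div_eq_inv_mul]
    rw [ENNReal.le_div_iff_mul_le (Or.inl (by simpa using hpos)) (Or.inl ENNReal.ofReal_ne_top),
      mul_comm]
    exact h1
  rw [eLpNorm_exponent_top] at h2
  filter_upwards [ae_le_eLpNormEssSup (f := heatConv T t ht) (μ := volume)] with x hx
  have h3 := hx.trans h2
  rwa [← ofReal_norm, ENNReal.ofReal_le_ofReal_iff (by positivity)] at h3

/-- The basic estimate for frequency localised pieces of a distribution in `Ḃ^{-β,∞}_∞`: a symbol
`m (ξ / R)`, with `m` smooth and compactly supported, is `e^{-4π²|ξ/R|²}` times a symbol of the same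
kind, that is, the heat flow at time `R⁻²` followed by convolution with a kernel whose
`L¹` norm does not depend on `R`. -/
theorem norm_apply_shift_fourier_le (m : 𝓢(Rn n, ℂ)) (hm : HasCompactSupport m) :
    ∃ C, 0 ≤ C ∧ ∀ (β : ℝ) (T : 𝓢'(Rn n, ℂ)), besovNorm β T < ⊤ →
      ∀ (R : ℝ) (hR : 0 < R) (x : Rn n),
        ‖T (shift x (𝓕 (dil (inv_pos.2 hR) m)))‖ ≤ C * R ^ β * (besovNorm β T).toReal := by
  -- the quotient of `m` by the gaussian
  have hexp : ContDiff ℝ ∞ fun ξ : Rn n =>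
      ((Real.exp (4 * Real.pi ^ 2 * ‖ξ‖ ^ 2) : ℝ) : ℂ) :=
    Complex.ofRealCLM.contDiff.comp
      (Real.contDiff_exp.comp (contDiff_const.mul (contDiff_norm_sq ℝ)))
  let q : 𝓢(Rn n, ℂ) := HasCompactSupport.toSchwartzMap
    (f := fun ξ => m ξ * ((Real.exp (4 * Real.pi ^ 2 * ‖ξ‖ ^ 2) : ℝ) : ℂ))
    (hm.mul_right) ((m.smooth _).mul hexp)
  have hq : ∀ ξ, q ξ = m ξ * ((Real.exp (4 * Real.pi ^ 2 * ‖ξ‖ ^ 2) : ℝ) : ℂ) := fun ξ => rfl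
  refine ⟨∫ y, ‖𝓕 q y‖, integral_nonneg fun _ => norm_nonneg _, fun β T hT R hR x => ?_⟩
  have ht : 0 < (R⁻¹) ^ 2 := by positivity
  set Q := dil (inv_pos.2 hR) q with hQ
  have hfac : dil (inv_pos.2 hR) m =
      SchwartzMap.smulLeftCLM ℂ (Q : Rn n → ℂ) (𝓕⁻ (heatKernel n _ ht)) := by
    ext ξ
    rw [SchwartzMap.smulLeftCLM_apply_apply Q.hasTemperateGrowth, fourierInv_heatKernel,
      hQ, dil_apply, dil_apply, hq, smul_eq_mul, mul_assoc, ← Complex.ofReal_mul, ← Real.exp_add,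
      norm_smul, Real.norm_of_nonneg (inv_pos.2 hR).le]
    have : 4 * Real.pi ^ 2 * (R⁻¹ * ‖ξ‖) ^ 2 + -(4 * Real.pi ^ 2 * R⁻¹ ^ 2 * ‖ξ‖ ^ 2) = 0 := by
      ring
    rw [this, Real.exp_zero, Complex.ofReal_one, mul_one]
  rw [hfac, fourier_smul_fourierInv, conv_comm, shift_conv, apply_conv]
  set M := R ^ β * (besovNorm β T).toReal with hM
  have hM0 : 0 ≤ M := by positivity
  have hbound : ∀ᵐ z, ‖shift x (𝓕 Q) z * T (shift z (heatKernel n _ ht))‖ ≤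
      ‖𝓕 Q (z - x)‖ * M := by
    filter_upwards [norm_heatConv_ae_le hT ht] with z hz
    rw [norm_mul]
    refine mul_le_mul_of_nonneg_left (hz.trans_eq ?_) (norm_nonneg _)
    rw [hM, ← Real.rpow_natCast, ← Real.rpow_mul (by positivity), Real.inv_rpow hR.le,
      ← Real.rpow_neg hR.le]
    congr 2
    push_cast
    ring
  have hint : Integrable fun z => ‖𝓕 Q (z - x)‖ * M :=
    ((𝓕 Q).integrable.norm.comp_sub_right x).mul_const M
  refine (norm_integral_le_of_norm_le hint hbound).trans (le_of_eq ?_)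
  rw [integral_mul_const, integral_sub_right_eq_self (fun z => ‖𝓕 Q z‖) x, hQ,
    integral_norm_fourier_dil_inv hR, hM, mul_assoc]

end HeatKernel

/-! ### Symbols and existence of the fractional Laplacian -/

section Symbols

variable {n : ℕ}

/-- Real powers of a function of temperate growth that is bounded away from `0` have temperate
growth. -/
theorem hasTemperateGrowth_rpow {w : Rn n → ℝ} (hw : w.HasTemperateGrowth) {a : ℝ} (ha : 0 < a)
    (hwa : ∀ x, a < w x) (r : ℝ) : (fun x => w x ^ r).HasTemperateGrowth := by
  have hdiff : ContDiffOn ℝ ∞ (fun y : ℝ => y ^ r) (Set.Ioi a) :=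
    contDiffOn_fun_id.rpow_const_of_ne fun y hy => (ha.trans hy).ne'
  have hunique : UniqueDiffOn ℝ (Set.Ioi a) := isOpen_Ioi.uniqueDiffOn
  refine Function.HasTemperateGrowth.comp' (g := fun y : ℝ => y ^ r) (t := Set.Ioi a)
    (by rintro - ⟨y, rfl⟩; exact hwa y) hunique hdiff (fun N => ?_) hw
  obtain ⟨k, hk⟩ := exists_nat_ge r
  refine ⟨k, ∑ i ∈ Finset.range (N + 1), ‖(descPochhammer ℝ i).eval r‖ * (1 + a ^ (r - i)),
    by positivity, fun i hi y hy => ?_⟩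
  have hy0 : 0 < y := ha.trans hy
  have hsm : ContDiffAt ℝ i (fun y : ℝ => y ^ r) y := Real.contDiffAt_rpow_const (Or.inl hy0.ne')
  rw [norm_iteratedFDerivWithin_eq_norm_iteratedDerivWithin,
    iteratedDerivWithin_eq_iteratedDeriv hunique hsm hy, iteratedDeriv_eq_iterate,
    Real.iter_deriv_rpow_const, norm_mul, Real.norm_of_nonneg (by positivity : 0 ≤ y ^ (r - i)),
    Real.norm_of_nonneg hy0.le]
  have h1 : (1 : ℝ) ≤ (1 + y) ^ k := one_le_pow₀ (by linarith)
  have h2 : y ^ (r - i) ≤ (1 + a ^ (r - i)) * (1 + y) ^ k := by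
    have ha' : 0 < a ^ (r - i) := by positivity
    rcases le_or_gt 0 (r - i) with h | h
    · calc y ^ (r - i) ≤ (1 + y) ^ (r - i) := by gcongr; linarith
        _ ≤ (1 + y) ^ (k : ℝ) := by
          gcongr
          · linarith
          · linarith [(Nat.cast_nonneg i : (0 : ℝ) ≤ i)]
        _ ≤ _ := by rw [Real.rpow_natCast]; nlinarith
    · calc y ^ (r - i) ≤ a ^ (r - i) := Real.rpow_le_rpow_of_nonpos ha hy.le h.le
        _ ≤ _ := by nlinarith
  calc ‖(descPochhammer ℝ i).eval r‖ * y ^ (r - i)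
      ≤ ‖(descPochhammer ℝ i).eval r‖ * ((1 + a ^ (r - i)) * (1 + y) ^ k) := by gcongr
    _ = ‖(descPochhammer ℝ i).eval r‖ * (1 + a ^ (r - i)) * (1 + y) ^ k := by ring
    _ ≤ _ := by
      gcongr
      exact Finset.single_le_sum
        (f := fun i : ℕ => ‖(descPochhammer ℝ i).eval r‖ * (1 + a ^ (r - i)))
        (fun _ _ => by positivity) (Finset.mem_range.2 (Nat.lt_succ_of_le hi))

/-- The admissible low-frequency cut-offs: smooth, compactly supported, and `1` near the origin. -/
structure IsCutoff (χ : Rn n → ℝ) : Prop where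
  smooth : ContDiff ℝ ∞ χ
  hasCompactSupport : HasCompactSupport χ
  eventually_eq_one : ∀ᶠ ξ in 𝓝 0, χ ξ = 1

theorem isCutoff_bump : IsCutoff (bump (Rn n)) :=
  ⟨(bump (Rn n)).contDiff, (bump (Rn n)).hasCompactSupport, (bump (Rn n)).eventuallyEq_one⟩

/-- Smooth functions with compact support in the complement of the origin. -/
structure IsAnnular (η : Rn n → ℝ) : Prop where
  smooth : ContDiff ℝ ∞ η
  hasCompactSupport : HasCompactSupport η
  eventually_eq_zero : ∀ᶠ ξ in 𝓝 0, η ξ = 0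

theorem IsCutoff.comp_smul {χ : Rn n → ℝ} (hχ : IsCutoff χ) {ε : ℝ} (hε : 0 < ε) :
    IsCutoff fun ξ => χ (ε⁻¹ • ξ) where
  smooth := hχ.smooth.comp (contDiff_const_smul _)
  hasCompactSupport := hχ.hasCompactSupport.comp_smul (inv_pos.2 hε).ne'
  eventually_eq_one := by
    have h : Tendsto (fun ξ : Rn n => ε⁻¹ • ξ) (𝓝 0) (𝓝 0) := by
      have : Continuous fun ξ : Rn n => ε⁻¹ • ξ := by fun_prop
      simpa using this.tendsto 0
    exact h.eventually hχ.eventually_eq_one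

theorem IsCutoff.sub {χ χ' : Rn n → ℝ} (hχ : IsCutoff χ) (hχ' : IsCutoff χ') :
    IsAnnular fun ξ => χ ξ - χ' ξ where
  smooth := hχ.smooth.sub hχ'.smooth
  hasCompactSupport := hχ.hasCompactSupport.sub hχ'.hasCompactSupport
  eventually_eq_zero := by
    filter_upwards [hχ.eventually_eq_one, hχ'.eventually_eq_one] with ξ h h'
    rw [h, h', sub_self]

/-- The symbol `η(ξ) (2π|ξ|)^σ`, for `η` smooth with compact support away from the origin (and any
real `σ`), as a Schwartz function. -/
def annularS (σ : ℝ) {η : Rn n → ℝ} (hη : IsAnnular η) : 𝓢(Rn n, ℂ) :=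
  HasCompactSupport.toSchwartzMap
    (f := fun ξ => ((η ξ * (2 * Real.pi * ‖ξ‖) ^ σ : ℝ) : ℂ))
    ((hη.hasCompactSupport.mul_right).comp_left (g := Complex.ofReal) (by simp))
    (Complex.ofRealCLM.contDiff.comp (contDiff_iff_contDiffAt.2 fun ξ => by
      by_cases h0 : ξ = 0
      · subst h0
        refine (contDiffAt_const (c := (0 : ℝ))).congr_of_eventuallyEq ?_
        filter_upwards [hη.eventually_eq_zero] with ξ h
        change η ξ * _ = 0
        rw [h, zero_mul]
      · refine hη.smooth.contDiffAt.mul (ContDiffAt.rpow_const_of_ne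
          (contDiffAt_const.mul (contDiffAt_norm ℝ h0)) ?_)
        have := norm_pos_iff.2 h0
        positivity))

theorem annularS_apply (σ : ℝ) {η : Rn n → ℝ} (hη : IsAnnular η) (ξ : Rn n) :
    annularS σ hη ξ = ((η ξ * (2 * Real.pi * ‖ξ‖) ^ σ : ℝ) : ℂ) := rfl

theorem hasCompactSupport_annularS (σ : ℝ) {η : Rn n → ℝ} (hη : IsAnnular η) :
    HasCompactSupport (annularS σ hη) :=
  (hη.hasCompactSupport.mul_right).comp_left (g := Complex.ofReal) (by simp)

theorem hasTemperateGrowth_truncSymbol (σ : ℝ) {χ : Rn n → ℝ} (hχ : IsCutoff χ) {ε : ℝ}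
    (hε : 0 < ε) : (truncSymbol σ χ ε).HasTemperateGrowth := by
  have hχε := hχ.comp_smul hε
  obtain ⟨ρ, hρ, hone⟩ := Metric.eventually_nhds_iff.1 hχε.eventually_eq_one
  -- `w` agrees with `(2π|ξ|)²` where the cut-off is not `1`, and is bounded away from `0`
  let w : Rn n → ℝ := fun ξ => (2 * Real.pi) ^ 2 * ‖ξ‖ ^ 2 + bump (Rn n) ((ρ / 2)⁻¹ • ξ)
  have hb := isCutoff_bump (n := n).comp_smul (half_pos hρ)
  have hw : w.HasTemperateGrowth := by
    have h1 := hb.hasCompactSupport.hasTemperateGrowth hb.smooth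
    have h2 : (fun ξ : Rn n => (2 * Real.pi) ^ 2 * ‖ξ‖ ^ 2).HasTemperateGrowth := by fun_prop
    exact h2.add h1
  have hwa : ∀ ξ, min 1 (Real.pi ^ 2 * ρ ^ 2) / 2 < w ξ := fun ξ => by
    have hm : 0 < min 1 (Real.pi ^ 2 * ρ ^ 2) := by positivity
    refine lt_of_lt_of_le (half_lt_self hm) ?_
    rcases le_or_gt ‖(ρ / 2)⁻¹ • ξ‖ 1 with h | h
    · refine (min_le_left _ _).trans ?_
      simp only [w, bump_eq_one h]
      have : 0 ≤ (2 * Real.pi) ^ 2 * ‖ξ‖ ^ 2 := by positivity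
      linarith
    · refine (min_le_right _ _).trans ?_
      have h3 : ρ / 2 ≤ ‖ξ‖ := by
        rw [norm_smul, norm_inv, Real.norm_of_nonneg (by positivity), ← div_eq_inv_mul,
          lt_div_iff₀ (by positivity), one_mul] at h
        exact h.le
      calc Real.pi ^ 2 * ρ ^ 2 = (2 * Real.pi) ^ 2 * (ρ / 2) ^ 2 := by ring
        _ ≤ (2 * Real.pi) ^ 2 * ‖ξ‖ ^ 2 := by gcongr
        _ ≤ w ξ := le_add_of_nonneg_right (bump (Rn n)).nonneg
  have hpow := hasTemperateGrowth_rpow hw (by positivity) hwa (σ / 2)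
  have hfac : truncSymbol σ χ ε = fun ξ => (((1 - χ (ε⁻¹ • ξ)) * w ξ ^ (σ / 2) : ℝ) : ℂ) := by
    funext ξ
    rw [truncSymbol]
    congr 1
    rcases lt_or_ge ‖ξ‖ ρ with h | h
    · have h1 : χ (ε⁻¹ • ξ) = 1 := hone (by rwa [dist_zero_right])
      rw [h1, sub_self, zero_mul, zero_mul]
    · have h1 : w ξ = (2 * Real.pi * ‖ξ‖) ^ 2 := by
        have h2 : bump (Rn n) ((ρ / 2)⁻¹ • ξ) = 0 := by
          refine bump_eq_zero ?_
          rw [norm_smul, norm_inv, Real.norm_of_nonneg (by positivity), ← div_eq_inv_mul,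
            le_div_iff₀ (by positivity)]
          linarith
        simp only [w]
        rw [h2, add_zero, mul_pow (2 * Real.pi)]
      rw [h1, ← Real.rpow_natCast, ← Real.rpow_mul (by positivity)]
      congr 2
      push_cast
      ring
  rw [hfac]
  have h1 := hχε.hasCompactSupport.hasTemperateGrowth hχε.smooth
  have h2 : (fun ξ : Rn n => 1 - χ (ε⁻¹ • ξ)).HasTemperateGrowth :=
    (Function.HasTemperateGrowth.const 1).sub h1
  exact Function.Complex.hasTemperateGrowth_ofReal.comp (h2.mul hpow)

/-- The action on test functions of the Fourier multiplier with symbol `m`, so that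
`(m(D) T)(φ) = T (multOp m φ)` holds by definition. -/
def multOp (m : Rn n → ℂ) (φ : 𝓢(Rn n, ℂ)) : 𝓢(Rn n, ℂ) :=
  𝓕 (SchwartzMap.smulLeftCLM ℂ m (𝓕⁻ φ))

theorem multOp_sub {m₁ m₂ : Rn n → ℂ} (h₁ : m₁.HasTemperateGrowth) (h₂ : m₂.HasTemperateGrowth)
    (φ : 𝓢(Rn n, ℂ)) : multOp (m₁ - m₂) φ = multOp m₁ φ - multOp m₂ φ := by
  rw [multOp, SchwartzMap.smulLeftCLM_sub h₁ h₂]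
  simp [multOp, sub_eq_add_neg, FourierTransform.fourier_add, FourierTransform.fourier_neg]

theorem conv_smul (c : ℂ) (φ K : 𝓢(Rn n, ℂ)) : conv φ (c • K) = c • conv φ K :=
  map_smul (SchwartzMap.convolution (ContinuousLinearMap.mul ℂ ℂ) φ) c K

theorem multOp_schwartz (m φ : 𝓢(Rn n, ℂ)) : multOp (m : Rn n → ℂ) φ = conv φ (𝓕 m) :=
  fourier_smul_fourierInv m φ

/-- The difference of two truncations of `|ξ|^σ`, at scales comparable to `R`, is a dilated annular
symbol. -/
theorem truncSymbol_sub (σ : ℝ) {χ χ' : Rn n → ℝ} (hχ : IsCutoff χ) (hχ' : IsCutoff χ') {ε ε' : ℝ}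
    (hε : 0 < ε) (hε' : 0 < ε') {R : ℝ} (hR : 0 < R) :
    truncSymbol σ χ' (R * ε') - truncSymbol σ χ (R * ε) =
      (((R ^ σ : ℝ) : ℂ) •
        dil (inv_pos.2 hR) (annularS σ ((hχ.comp_smul hε).sub (hχ'.comp_smul hε'))) :
          𝓢(Rn n, ℂ)) := by
  funext ξ
  have h : (2 * Real.pi * ‖ξ‖) ^ σ = R ^ σ * (2 * Real.pi * ‖R⁻¹ • ξ‖) ^ σ := by
    rw [← Real.mul_rpow hR.le (by positivity), norm_smul, norm_inv, Real.norm_of_nonneg hR.le]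
    congr 1
    field_simp
  rw [Pi.sub_apply, smul_apply, dil_apply, annularS_apply, truncSymbol, truncSymbol, h,
    smul_smul, smul_smul, smul_eq_mul, mul_inv_rev, mul_inv_rev]
  push_cast
  ring

/-- Frequency pieces at scale `R` of `|D|^σ T` are bounded by `R ^ (σ + β)`. -/
theorem norm_apply_multOp_sub_le (σ : ℝ) {χ χ' : Rn n → ℝ} (hχ : IsCutoff χ) (hχ' : IsCutoff χ')
    {ε ε' : ℝ} (hε : 0 < ε) (hε' : 0 < ε') :
    ∃ C, 0 ≤ C ∧ ∀ (β : ℝ) (T : 𝓢'(Rn n, ℂ)), besovNorm β T < ⊤ → ∀ R : ℝ, 0 < R →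
      ∀ φ : 𝓢(Rn n, ℂ), ‖T (multOp (truncSymbol σ χ' (R * ε')) φ) -
        T (multOp (truncSymbol σ χ (R * ε)) φ)‖ ≤
          C * R ^ (σ + β) * (besovNorm β T).toReal * ∫ x, ‖φ x‖ := by
  set m := annularS σ ((hχ.comp_smul hε).sub (hχ'.comp_smul hε')) with hm
  obtain ⟨C, hC, hb⟩ := norm_apply_shift_fourier_le m (hasCompactSupport_annularS σ _)
  refine ⟨C, hC, fun β T hT R hR φ => ?_⟩
  rw [← map_sub, ← multOp_sub (hasTemperateGrowth_truncSymbol σ hχ' (by positivity))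
    (hasTemperateGrowth_truncSymbol σ hχ (by positivity)), truncSymbol_sub σ hχ hχ' hε hε' hR,
    multOp_schwartz, FourierTransform.fourier_smul, conv_smul, map_smul, norm_smul, apply_conv,
    Complex.norm_real, Real.norm_of_nonneg (by positivity), ← hm]
  have h1 : ‖∫ x, φ x * T (shift x (𝓕 (dil (inv_pos.2 hR) m)))‖ ≤
      ∫ x, ‖φ x‖ * (C * R ^ β * (besovNorm β T).toReal) := by
    refine norm_integral_le_of_norm_le (φ.integrable.norm.mul_const _) (ae_of_all _ fun x => ?_)
    rw [norm_mul]
    exact mul_le_mul_of_nonneg_left (hb β T hT R hR x) (norm_nonneg _)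
  rw [integral_mul_const] at h1
  calc R ^ σ * ‖∫ x, φ x * T (shift x (𝓕 (dil (inv_pos.2 hR) m)))‖
      ≤ R ^ σ * ((∫ x, ‖φ x‖) * (C * R ^ β * (besovNorm β T).toReal)) := by gcongr
    _ = _ := by rw [Real.rpow_add hR]; ring

/-- A linear functional bounded by the `L¹` norm is a tempered distribution. -/
theorem continuous_of_le_integral_norm (V : 𝓢(Rn n, ℂ) →ₗ[ℂ] ℂ) (C : ℝ)
    (h : ∀ φ, ‖V φ‖ ≤ C * ∫ x, ‖φ x‖) : Continuous V := by
  refine continuous_of_continuousAt_zero V ?_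
  rw [ContinuousAt, map_zero]
  refine squeeze_zero_norm h ?_
  have h1 : Continuous fun φ : 𝓢(Rn n, ℂ) => C * ‖SchwartzMap.toLpCLM ℂ ℂ 1 volume φ‖ := by
    fun_prop
  have h2 := h1.tendsto 0
  rw [map_zero, norm_zero, mul_zero] at h2
  refine h2.congr fun φ => ?_
  rw [SchwartzMap.toLpCLM_apply, SchwartzMap.norm_toLp_one]

/-- Distributions in `Ḃ^{-β,∞}_∞` have a fractional Laplacian of any order `σ > -β`: the
truncations at the scales `2^{-J} ε` form a geometric Cauchy sequence, when tested against `φ`. -/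
theorem exists_isFracLaplacian {σ β : ℝ} (hσβ : 0 < σ + β) {T : 𝓢'(Rn n, ℂ)}
    (hT : besovNorm β T < ⊤) : ∃ U : 𝓢'(Rn n, ℂ), IsFracLaplacian σ T U := by
  set A := (besovNorm β T).toReal
  let c (χ : Rn n → ℝ) (ε : ℝ) (φ : 𝓢(Rn n, ℂ)) : ℂ := T (multOp (truncSymbol σ χ ε) φ)
  set r : ℝ := (1 / 2 : ℝ) ^ (σ + β) with hr
  have hr0 : 0 < r := by positivity
  have hr1 : r < 1 := Real.rpow_lt_one (by norm_num) (by norm_num) hσβ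
  have hpow : ∀ J : ℕ, ((1 / 2 : ℝ) ^ J) ^ (σ + β) = r ^ J := fun J => by
    rw [hr, ← Real.rpow_natCast, ← Real.rpow_natCast, ← Real.rpow_mul (by norm_num),
      ← Real.rpow_mul (by norm_num), mul_comm]
  -- consecutive dyadic truncations differ by a geometrically small amount
  have hgeom : ∀ χ, IsCutoff χ → ∃ C, 0 ≤ C ∧ ∀ ε, 0 < ε → ∀ φ (J : ℕ),
      dist (c χ (ε * (1 / 2) ^ J) φ) (c χ (ε * (1 / 2) ^ (J + 1)) φ) ≤
        (C * ε ^ (σ + β) * ∫ x, ‖φ x‖) * r ^ J := by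
    intro χ hχ
    obtain ⟨C, hC, h⟩ := norm_apply_multOp_sub_le σ hχ hχ one_pos (half_pos one_pos)
    refine ⟨C * A, by positivity, fun ε hε φ J => ?_⟩
    have h1 := h β T hT (ε * (1 / 2) ^ J) (by positivity) φ
    rw [dist_comm, dist_eq_norm]
    rw [mul_one, mul_assoc ε, ← pow_succ, Real.mul_rpow hε.le (by positivity), hpow] at h1
    refine h1.trans (le_of_eq ?_)
    ring
  -- the limit does not depend on the cut-off or on the starting scale
  have hindep : ∀ χ, IsCutoff χ → ∀ ε, 0 < ε → ∀ φ,
      Tendsto (fun J : ℕ => c χ (ε * (1 / 2) ^ J) φ - c (bump (Rn n)) ((1 / 2) ^ J) φ) atTop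
        (𝓝 0) := by
    intro χ hχ ε hε φ
    obtain ⟨C, hC, h⟩ := norm_apply_multOp_sub_le σ isCutoff_bump hχ one_pos hε
    refine squeeze_zero_norm (a := fun J : ℕ => C * r ^ J * A * ∫ x, ‖φ x‖) (fun J => ?_) ?_
    · have h1 := h β T hT ((1 / 2) ^ J) (by positivity) φ
      rwa [mul_one, mul_comm _ ε, hpow] at h1
    · have h2 := (((tendsto_pow_atTop_nhds_zero_of_lt_one hr0.le hr1).const_mul C).mul_const
        A).mul_const (∫ x, ‖φ x‖)
      simpa using h2
  obtain ⟨_, -, hgeom₀⟩ := hgeom _ isCutoff_bump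
  have hcauchy : ∀ φ, ∃ a, Tendsto (fun J : ℕ => c (bump (Rn n)) ((1 / 2) ^ J) φ) atTop (𝓝 a) :=
    fun φ => by
      have h := hgeom₀ 1 one_pos φ
      simp only [one_mul] at h
      exact cauchySeq_tendsto_of_complete (cauchySeq_of_le_geometric r _ hr1 h)
  choose u hu using hcauchy
  have hlim : ∀ χ, IsCutoff χ → ∀ ε, 0 < ε → ∀ φ,
      Tendsto (fun J : ℕ => c χ (ε * (1 / 2) ^ J) φ) atTop (𝓝 (u φ)) := fun χ hχ ε hε φ => by
    simpa using (hindep χ hχ ε hε φ).add (hu φ)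
  have hdist : ∀ χ, IsCutoff χ → ∃ C, ∀ ε, 0 < ε → ∀ φ,
      dist (c χ ε φ) (u φ) ≤ C * ε ^ (σ + β) * (∫ x, ‖φ x‖) / (1 - r) := by
    intro χ hχ
    obtain ⟨C, hC, h⟩ := hgeom χ hχ
    refine ⟨C, fun ε hε φ => ?_⟩
    have := dist_le_of_le_geometric_of_tendsto₀ r _ hr1 (h ε hε φ) (hlim χ hχ ε hε φ)
    simpa using this
  let L (ε : ℝ) : 𝓢(Rn n, ℂ) →ₗ[ℂ] ℂ :=
    (TemperedDistribution.fourierMultiplierCLM ℂ (truncSymbol σ (bump (Rn n)) ε) T :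
      𝓢(Rn n, ℂ) →L[ℂ] ℂ)
  let Ul : 𝓢(Rn n, ℂ) →ₗ[ℂ] ℂ :=
    linearMapOfTendsto u (fun J : ℕ => L ((1 / 2) ^ J)) (tendsto_pi_nhds.2 hu)
  -- the limit differs from a single truncation by a functional bounded in `L¹`
  have hUl : Continuous Ul := by
    obtain ⟨C, hC⟩ := hdist _ isCutoff_bump
    have h1 : Continuous (Ul - L 1) := by
      refine continuous_of_le_integral_norm _ (C / (1 - r)) fun φ => ?_
      have := hC 1 one_pos φ
      rw [dist_comm, dist_eq_norm, Real.one_rpow, mul_one] at this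
      refine this.trans (le_of_eq ?_)
      ring
    have h2 : Continuous (L 1) := (TemperedDistribution.fourierMultiplierCLM ℂ
      (truncSymbol σ (bump (Rn n)) 1) T).continuous
    have h3 := h1.add h2
    have : (Ul : 𝓢(Rn n, ℂ) → ℂ) = fun φ => (Ul - L 1) φ + L 1 φ := by
      funext φ
      simp
    rw [this]
    exact h3
  let Uc : 𝓢'(Rn n, ℂ) := (⟨Ul, hUl⟩ : 𝓢(Rn n, ℂ) →L[ℂ] ℂ)
  refine ⟨Uc, fun χ h1 h2 h3 => ?_⟩
  rw [PointwiseConvergenceCLM.tendsto_iff_forall_tendsto]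
  intro φ
  obtain ⟨C, hC⟩ := hdist χ ⟨h1, h2, h3⟩
  rw [tendsto_iff_dist_tendsto_zero]
  refine squeeze_zero' (Eventually.of_forall fun _ => dist_nonneg)
    (eventually_nhdsWithin_of_forall fun ε hε => hC ε hε φ) ?_
  have h4 : Tendsto (fun ε : ℝ => ε ^ (σ + β)) (𝓝[>] 0) (𝓝 0) := by
    have := (Real.continuousAt_rpow_const 0 (σ + β) (Or.inr hσβ.le)).tendsto
    rw [Real.zero_rpow hσβ.ne'] at this
    exact this.mono_left nhdsWithin_le_nhds
  have h5 := (((h4.const_mul C).mul_const (∫ x, ‖φ x‖)).div_const (1 - r))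
  simpa using h5

end Symbols

/-! ### High frequencies of smooth functions -/

section LocalRegularity

variable {n : ℕ}

theorem lineDeriv_shift (v x : Rn n) (K : 𝓢(Rn n, ℂ)) : ∂_{v} (shift x K) = shift x (∂_{v} K) := by
  ext y
  change ∂_{v} (shift x K) y = ∂_{v} K (y - x)
  rw [SchwartzMap.lineDerivOp_apply, SchwartzMap.lineDerivOp_apply, lineDeriv, lineDeriv]
  congr 1
  funext t
  change K (y + t • v - x) = _
  rw [add_sub_right_comm]

theorem laplacian_shift (x : Rn n) (K : 𝓢(Rn n, ℂ)) : Δ (shift x K) = shift x (Δ K) := by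
  rw [SchwartzMap.laplacian_eq_sum (EuclideanSpace.basisFun (Fin n) ℝ),
    SchwartzMap.laplacian_eq_sum (EuclideanSpace.basisFun (Fin n) ℝ)]
  simp only [lineDeriv_shift, map_sum]

/-- `Δ 𝓕 g = -𝓕 ((2π|ξ|)² g)`. -/
theorem laplacian_fourier (g : 𝓢(Rn n, ℂ)) :
    Δ (𝓕 g) = -(2 * Real.pi) ^ 2 • 𝓕 (SchwartzMap.smulLeftCLM ℂ
      (fun ξ : Rn n => Complex.ofReal (‖ξ‖ ^ 2)) g) := by
  ext y
  have h := congrArg (fun S : 𝓢'(Rn n, ℂ) => S (𝓕 g))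
    (TemperedDistribution.laplacian_eq_fourierMultiplierCLM (TemperedDistribution.delta y))
  simpa using h

theorem contDiff_laplacian {f : Rn n → ℂ} (hf : ContDiff ℝ ∞ f) : ContDiff ℝ ∞ (Δ f) := by
  rw [InnerProductSpace.laplacian_eq_iteratedFDeriv_orthonormalBasis f
    (EuclideanSpace.basisFun (Fin n) ℝ)]
  refine ContDiff.sum fun i _ => ?_
  have h : ContDiff ℝ ∞ (iteratedFDeriv ℝ 2 f) := hf.iteratedFDeriv_right le_rfl
  exact (ContinuousMultilinearMap.apply ℝ (fun _ : Fin 2 => Rn n) ℂ _).contDiff.comp h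

theorem IsRepresentedBy.laplacian {T : 𝓢'(Rn n, ℂ)} {f : Rn n → ℂ} (hf : ContDiff ℝ ∞ f)
    (hT : IsRepresentedBy T f) : IsRepresentedBy (Δ T) (Δ f) := by
  refine ⟨(contDiff_laplacian hf).continuous.locallyIntegrable, fun φ hφ => ?_⟩
  obtain ⟨r, hr0, hr⟩ : ∃ r : ℝ, 0 < r ∧ tsupport φ ⊆ Metric.ball 0 r := by
    obtain ⟨r, hr⟩ := (Metric.isBounded_iff_subset_ball 0).1 hφ.isBounded
    exact ⟨max r 1, by positivity, hr.trans (Metric.ball_subset_ball (le_max_left _ _))⟩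
  -- integrate by parts against a Schwartz function that agrees with `f` near the support of `φ`
  let g : 𝓢(Rn n, ℂ) := HasCompactSupport.toSchwartzMap
    (f := fun x => dil (inv_pos.2 hr0) (bumpS (Rn n)) x * f x)
    (hasCompactSupport_dil_bumpS _).mul_right
    (((dil (inv_pos.2 hr0) (bumpS (Rn n))).smooth _).mul hf)
  have hg : ∀ x ∈ Metric.ball (0 : Rn n) r, g x = f x := fun x hx => by
    change dil (inv_pos.2 hr0) (bumpS (Rn n)) x * f x = f x
    rw [dil_apply, bumpS_apply, bump_eq_one, Complex.ofReal_one, one_mul]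
    rw [norm_smul, norm_inv, Real.norm_of_nonneg hr0.le, ← div_eq_inv_mul, div_le_one hr0]
    exact (mem_ball_zero_iff.1 hx).le
  have hgΔ : ∀ x ∈ Metric.ball (0 : Rn n) r, Δ g x = Δ f x := fun x hx => by
    rw [SchwartzMap.laplacian_apply]
    exact (InnerProductSpace.laplacian_congr_nhds
      (Filter.eventuallyEq_of_mem (Metric.isOpen_ball.mem_nhds hx) hg)).eq_of_nhds
  have hφ0 : ∀ x, x ∉ tsupport φ → Δ φ x = 0 := fun x hx => by
    rw [SchwartzMap.laplacian_apply]
    have h : (φ : Rn n → ℂ) =ᶠ[𝓝 x] fun _ => 0 := notMem_tsupport_iff_eventuallyEq.1 hx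
    rw [(InnerProductSpace.laplacian_congr_nhds h).eq_of_nhds]
    simp
  have hΔφ : HasCompactSupport (Δ φ : 𝓢(Rn n, ℂ)) :=
    HasCompactSupport.of_support_subset_isCompact hφ fun x hx => by
      by_contra h
      exact hx (hφ0 x h)
  rw [TemperedDistribution.laplacian_apply_apply, hT.2 _ hΔφ]
  have h1 : ∀ x, Δ φ x * f x = g x * Δ φ x := fun x => by
    by_cases hx : x ∈ tsupport φ
    · rw [hg x (hr hx), mul_comm]
    · rw [hφ0 x hx, zero_mul, mul_zero]
  have h2 : ∀ x, Δ g x * φ x = φ x * Δ f x := fun x => by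
    by_cases hx : x ∈ tsupport φ
    · rw [hgΔ x (hr hx), mul_comm]
    · rw [image_eq_zero_of_notMem_tsupport hx, zero_mul, mul_zero]
  simp only [h1]
  rw [SchwartzMap.integral_mul_laplacian_right_eq_left]
  simp only [h2]

/-- The kernels `R ^ n K (R x)`, `R ≥ 1`, tested against a distribution that is a continuous
function, give locally bounded functions uniformly in `R`: the part of the kernel inside the unit
ball sees only the function, and the part outside is negligible in the Schwartz space. -/
theorem exists_bound_of_continuous {T : 𝓢'(Rn n, ℂ)} {f : Rn n → ℂ} (hf : Continuous f)
    (hT : IsRepresentedBy T f) (m : 𝓢(Rn n, ℂ)) (ρ : ℝ) :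
    ∃ C, 0 ≤ C ∧ ∀ (R : ℝ) (hR : 0 < R), 1 ≤ R → ∀ x : Rn n, ‖x‖ ≤ ρ →
      ‖T (shift x (𝓕 (dil (inv_pos.2 hR) m)))‖ ≤ C := by
  set K := 𝓕 m with hK
  have hsplit : ∀ (R : ℝ) (hR : 0 < R) (x : Rn n), shift x (𝓕 (dil (inv_pos.2 hR) m)) =
      (R : ℂ) ^ n • shift x (dil hR (head hR K)) +
        (R : ℂ) ^ n • shift x (dil hR (K - head hR K)) := fun R hR x => by
    ext y
    change 𝓕 (dil (inv_pos.2 hR) m) (y - x) = (R : ℂ) ^ n * head hR K (R • (y - x)) +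
      (R : ℂ) ^ n * (K (R • (y - x)) - head hR K (R • (y - x)))
    rw [fourier_dil_inv hR, finrank_euclideanSpace_fin]
    ring
  obtain ⟨S, hS⟩ := (isCompact_closedBall (0 : Rn n) (ρ + 2)).exists_bound_of_continuousOn
    hf.continuousOn
  -- the part of the kernel near the origin
  have hnear : ∀ (R : ℝ) (hR : 0 < R) (x : Rn n), ‖x‖ ≤ ρ →
      ‖T ((R : ℂ) ^ n • shift x (dil hR (head hR K)))‖ ≤ |S| * ∫ y, ‖K y‖ := by
    intro R hR x hx
    have hzero : ∀ y, 2 < ‖y - x‖ → shift x (dil hR (head hR K)) y = 0 := fun y hy => by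
      change head hR K (R • (y - x)) = 0
      refine head_eq_zero hR K ?_
      rw [norm_smul, Real.norm_of_nonneg hR.le, mul_comm]
      gcongr
    have hcs : HasCompactSupport (shift x (dil hR (head hR K))) :=
      HasCompactSupport.of_support_subset_isCompact (isCompact_closedBall x 2) fun y hy => by
        rw [mem_closedBall_iff_norm]
        by_contra h
        exact hy (hzero y (not_le.1 h))
    have hRn : ‖(R : ℂ) ^ n‖ = R ^ n := by
      rw [norm_pow, Complex.norm_real, Real.norm_of_nonneg hR.le]
    rw [map_smul, norm_smul, hRn, hT.2 _ hcs]
    have hint : Integrable fun y => ‖dil hR K (y - x)‖ * |S| :=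
      ((dil hR K).integrable.norm.comp_sub_right x).mul_const _
    have h1 := norm_integral_le_of_norm_le (f := fun y => shift x (dil hR (head hR K)) y * f y)
      hint (ae_of_all _ fun y => by
        rw [norm_mul]
        rcases lt_or_ge 2 ‖y - x‖ with hy | hy
        · rw [hzero y hy, norm_zero, zero_mul]
          positivity
        · have hy' : y ∈ Metric.closedBall (0 : Rn n) (ρ + 2) := by
            rw [mem_closedBall_zero_iff]
            calc ‖y‖ = ‖x + (y - x)‖ := by rw [add_sub_cancel]
              _ ≤ ‖x‖ + ‖y - x‖ := norm_add_le _ _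
              _ ≤ ρ + 2 := add_le_add hx hy
          exact mul_le_mul (norm_head_le hR K _) ((hS y hy').trans (le_abs_self S))
            (norm_nonneg _) (norm_nonneg _))
    rw [integral_mul_const, integral_sub_right_eq_self (fun y => ‖dil hR K y‖) x] at h1
    have h2 : ∫ y, ‖dil hR K y‖ = (R ^ n)⁻¹ * ∫ y, ‖K y‖ := by
      have := Measure.integral_comp_smul (volume : Measure (Rn n)) (fun y => ‖K y‖) R
      rw [finrank_euclideanSpace_fin, abs_of_pos (by positivity), smul_eq_mul] at this
      exact this
    rw [h2] at h1
    calc R ^ n * ‖∫ y, shift x (dil hR (head hR K)) y * f y‖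
        ≤ R ^ n * ((R ^ n)⁻¹ * (∫ y, ‖K y‖) * |S|) := by gcongr
      _ = |S| * ∫ y, ‖K y‖ := by field_simp
  -- the part of the kernel away from the origin
  obtain ⟨N, C, hC, hTb⟩ := temperedDistribution_bound T
  have hρ' : 0 < 1 + |ρ| := by positivity
  choose B hB hb using fun i : ℕ × ℕ => tail_decay i.1 i.2 (n + N) K
  set D := ∑ i ∈ Finset.range (N + 1) ×ˢ Finset.range (N + 1), B i with hD
  have hD0 : 0 ≤ D := Finset.sum_nonneg fun i _ => hB i
  have hBD : ∀ k ≤ N, ∀ l ≤ N, B (k, l) ≤ D := fun k hk l hl =>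
    Finset.single_le_sum (f := B) (fun i _ => hB i) (by
      simp only [Finset.mem_product, Finset.mem_range]
      omega)
  have hfar : ∀ (R : ℝ) (hR : 0 < R), 1 ≤ R → ∀ x : Rn n, ‖x‖ ≤ ρ →
      ‖T ((R : ℂ) ^ n • shift x (dil hR (K - head hR K)))‖ ≤
        C * ((1 + |ρ|) ^ N * (2 ^ N * (D + D))) := by
    intro R hR hR1 x hx
    have hRn : ‖(R : ℂ) ^ n‖ = R ^ n := by
      rw [norm_pow, Complex.norm_real, Real.norm_of_nonneg hR.le]
    set P : 𝓢(Rn n, ℂ) := K - head hR K with hP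
    refine hTb _ _ (by positivity) fun k hk l hl y => ?_
    have e : iteratedFDeriv ℝ l ((R : ℂ) ^ n • shift x (dil hR P) : 𝓢(Rn n, ℂ)) y =
        (R : ℂ) ^ n • iteratedFDeriv ℝ l (shift x (dil hR P)) y :=
      iteratedFDeriv_const_smul_apply ((shift x (dil hR P)).contDiffAt l)
    rw [e, norm_smul, hRn, iteratedFDeriv_shift, norm_iteratedFDeriv_dil]
    set z := R • (y - x) with hz
    have hyz : ‖y‖ ≤ (1 + ‖z‖) * (1 + |ρ|) := by
      refine (norm_le_one_add_mul x y).trans ?_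
      have h1 : ‖y - x‖ ≤ ‖z‖ := by
        rw [hz, norm_smul, Real.norm_of_nonneg hR.le]
        exact le_mul_of_one_le_left (norm_nonneg _) hR1
      have h2 : ‖x‖ ≤ |ρ| := hx.trans (le_abs_self _)
      gcongr
    have h2 : (1 + ‖z‖) ^ k ≤ 2 ^ N * (‖z‖ ^ 0 + ‖z‖ ^ k) := by
      have h := add_pow_le (zero_le_one) (norm_nonneg z) k
      rw [one_pow] at h
      rw [pow_zero]
      refine h.trans ?_
      gcongr
      · norm_num
      · omega
    have h3 : R ^ l ≤ R ^ N := pow_le_pow_right₀ hR1 hl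
    have h4 : (1 + |ρ|) ^ k ≤ (1 + |ρ|) ^ N :=
      pow_le_pow_right₀ (by linarith [abs_nonneg ρ]) hk
    have h5 := (hb (0, l) R hR hR1 z).trans (hBD 0 (Nat.zero_le _) l hl)
    have h6 := (hb (k, l) R hR hR1 z).trans (hBD k hk l hl)
    simp only [← hP] at h5 h6
    calc ‖y‖ ^ k * (R ^ n * (R ^ l * ‖iteratedFDeriv ℝ l P z‖))
        ≤ ((1 + ‖z‖) * (1 + |ρ|)) ^ k * (R ^ n * (R ^ N * ‖iteratedFDeriv ℝ l P z‖)) := by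
          gcongr
      _ = (1 + |ρ|) ^ k * ((1 + ‖z‖) ^ k * (R ^ (n + N) * ‖iteratedFDeriv ℝ l P z‖)) := by
          rw [mul_pow, pow_add]; ring
      _ ≤ (1 + |ρ|) ^ N * ((2 ^ N * (‖z‖ ^ 0 + ‖z‖ ^ k)) *
            (R ^ (n + N) * ‖iteratedFDeriv ℝ l P z‖)) := by gcongr
      _ = (1 + |ρ|) ^ N * (2 ^ N * (R ^ (n + N) * (‖z‖ ^ 0 * ‖iteratedFDeriv ℝ l P z‖) +
            R ^ (n + N) * (‖z‖ ^ k * ‖iteratedFDeriv ℝ l P z‖))) := by ring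
      _ ≤ (1 + |ρ|) ^ N * (2 ^ N * (D + D)) := by gcongr
  have hI : 0 ≤ ∫ y, ‖K y‖ := integral_nonneg fun _ => norm_nonneg _
  refine ⟨|S| * (∫ y, ‖K y‖) + C * ((1 + |ρ|) ^ N * (2 ^ N * (D + D))), by positivity,
    fun R hR hR1 x hx => ?_⟩
  rw [hsplit R hR x, map_add]
  exact (norm_add_le _ _).trans (add_le_add (hnear R hR x hx) (hfar R hR hR1 x hx))

/-- High frequency pieces of a distribution that is a smooth function decay rapidly, locally
uniformly: `m` powers of the Laplacian are moved from the kernel to the function. -/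
theorem exists_decay_of_contDiff (m : ℕ) {T : 𝓢'(Rn n, ℂ)} {f : Rn n → ℂ} (hf : ContDiff ℝ ∞ f)
    (hT : IsRepresentedBy T f) (σ : ℝ) {η : Rn n → ℝ} (hη : IsAnnular η) (ρ : ℝ) :
    ∃ C, 0 ≤ C ∧ ∀ (R : ℝ) (hR : 0 < R), 1 ≤ R → ∀ x : Rn n, ‖x‖ ≤ ρ →
      ‖T (shift x (𝓕 (dil (inv_pos.2 hR) (annularS σ hη))))‖ ≤ C * (R⁻¹ ^ 2) ^ m := by
  induction m generalizing T f σ with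
  | zero =>
    obtain ⟨C, hC, h⟩ := exists_bound_of_continuous hf.continuous hT (annularS σ hη) ρ
    exact ⟨C, hC, fun R hR hR1 x hx => by simpa using h R hR hR1 x hx⟩
  | succ m ih =>
    obtain ⟨C, hC, h⟩ := ih (contDiff_laplacian hf) (hT.laplacian hf) (σ - 2)
    refine ⟨C, hC, fun R hR hR1 x hx => ?_⟩
    have hgr : (fun ξ : Rn n => Complex.ofReal (‖ξ‖ ^ 2)).HasTemperateGrowth := by fun_prop
    have hsym : dil (inv_pos.2 hR) (annularS σ hη) =
        (((2 * Real.pi) ^ 2 * R⁻¹ ^ 2 : ℝ) : ℂ) • SchwartzMap.smulLeftCLM ℂ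
          (fun ξ : Rn n => Complex.ofReal (‖ξ‖ ^ 2))
          (dil (inv_pos.2 hR) (annularS (σ - 2) hη)) := by
      ext ξ
      rw [smul_apply, SchwartzMap.smulLeftCLM_apply_apply hgr, dil_apply, dil_apply,
        annularS_apply, annularS_apply, smul_eq_mul, smul_eq_mul, ← Complex.ofReal_mul,
        ← Complex.ofReal_mul]
      congr 1
      by_cases h0 : η (R⁻¹ • ξ) = 0
      · rw [h0]; ring
      · have hξ : 0 < ‖R⁻¹ • ξ‖ := by
          rw [norm_pos_iff]
          intro h1
          rw [h1] at h0
          exact h0 hη.eventually_eq_zero.self_of_nhds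
        have h2 : (2 * Real.pi * ‖R⁻¹ • ξ‖) ^ σ =
            (2 * Real.pi * ‖R⁻¹ • ξ‖) ^ 2 * (2 * Real.pi * ‖R⁻¹ • ξ‖) ^ (σ - 2) := by
          rw [← Real.rpow_natCast, ← Real.rpow_add (by positivity)]
          congr 1
          push_cast
          ring
        rw [h2, norm_smul, norm_inv, Real.norm_of_nonneg hR.le]
        ring
    have hfour : 𝓕 (dil (inv_pos.2 hR) (annularS σ hη)) =
        -(((R⁻¹ ^ 2 : ℝ) : ℂ) • Δ (𝓕 (dil (inv_pos.2 hR) (annularS (σ - 2) hη)))) := by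
      rw [hsym, FourierTransform.fourier_smul, laplacian_fourier]
      ext y
      simp only [smul_apply, neg_apply, Complex.real_smul, smul_eq_mul]
      push_cast
      ring
    have hshift : ∀ K : 𝓢(Rn n, ℂ), shift x (-(((R⁻¹ ^ 2 : ℝ) : ℂ) • Δ K)) =
        -(((R⁻¹ ^ 2 : ℝ) : ℂ) • Δ (shift x K)) := fun K => by
      rw [laplacian_shift]; rfl
    rw [hfour, hshift, map_neg, norm_neg, map_smul, norm_smul, Complex.norm_real,
      Real.norm_of_nonneg (by positivity), ← TemperedDistribution.laplacian_apply_apply, pow_succ]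
    calc R⁻¹ ^ 2 * ‖(Δ T) (shift x (𝓕 (dil (inv_pos.2 hR) (annularS (σ - 2) hη))))‖
        ≤ R⁻¹ ^ 2 * (C * (R⁻¹ ^ 2) ^ m) := by gcongr; exact h R hR hR1 x hx
      _ = _ := by ring

end LocalRegularity

/-! ### The Littlewood–Paley sum of the fractional Laplacian -/

section LittlewoodPaley

variable {n : ℕ}

variable (n) in
/-- The symbol `(b(ξ) - b(2ξ)) (2π|ξ|)^σ`, where `b` is the fixed bump function. -/
def lpSymbol (σ : ℝ) : 𝓢(Rn n, ℂ) :=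
  annularS σ ((isCutoff_bump.comp_smul one_pos).sub (isCutoff_bump.comp_smul (half_pos one_pos)))

theorem two_zpow_pos (j : ℤ) : (0 : ℝ) < 2 ^ j := by positivity

variable (n) in
/-- The `j`-th dyadic piece `(b(2^{-j} ξ) - b(2^{1-j} ξ)) (2π|ξ|)^σ` of the symbol `(2π|ξ|)^σ`. -/
def lpBlock (σ : ℝ) (j : ℤ) : 𝓢(Rn n, ℂ) :=
  ((((2 : ℝ) ^ j) ^ σ : ℝ) : ℂ) • dil (inv_pos.2 (two_zpow_pos j)) (lpSymbol n σ)

theorem lpBlock_eq (σ : ℝ) (j : ℤ) : (lpBlock n σ j : Rn n → ℂ) =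
    truncSymbol σ (bump (Rn n)) (2 ^ (j - 1)) - truncSymbol σ (bump (Rn n)) (2 ^ j) := by
  have h := truncSymbol_sub σ (isCutoff_bump (n := n)) isCutoff_bump one_pos (half_pos one_pos)
    (two_zpow_pos j)
  rw [mul_one, show (2 : ℝ) ^ j * (1 / 2) = 2 ^ (j - 1) by
    rw [zpow_sub_one₀ two_ne_zero, one_div]] at h
  exact h.symm

theorem lpBlock_apply (σ : ℝ) (j : ℤ) (ξ : Rn n) : lpBlock n σ j ξ =
    (((bump (Rn n) (((2 : ℝ) ^ j)⁻¹ • ξ) - bump (Rn n) (((2 : ℝ) ^ (j - 1))⁻¹ • ξ)) *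
      (2 * Real.pi * ‖ξ‖) ^ σ : ℝ) : ℂ) := by
  rw [lpBlock_eq, Pi.sub_apply, truncSymbol, truncSymbol]
  push_cast
  ring

/-- The dyadic pieces of `|D|^σ T`, as functions. -/
def lpCoeff (T : 𝓢'(Rn n, ℂ)) (σ : ℝ) (j : ℤ) (x : Rn n) : ℂ := T (shift x (𝓕 (lpBlock n σ j)))

theorem continuous_lpCoeff (T : 𝓢'(Rn n, ℂ)) (σ : ℝ) (j : ℤ) : Continuous (lpCoeff T σ j) :=
  continuous_apply_shift T _

theorem shift_smul (c : ℂ) (x : Rn n) (K : 𝓢(Rn n, ℂ)) : shift x (c • K) = c • shift x K :=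
  map_smul (SchwartzMap.compSubConstCLM ℂ x) c K

theorem norm_lpCoeff_eq (T : 𝓢'(Rn n, ℂ)) (σ : ℝ) (j : ℤ) (x : Rn n) :
    ‖lpCoeff T σ j x‖ = ((2 : ℝ) ^ j) ^ σ *
      ‖T (shift x (𝓕 (dil (inv_pos.2 (two_zpow_pos j)) (lpSymbol n σ))))‖ := by
  rw [lpCoeff, lpBlock, FourierTransform.fourier_smul, shift_smul, map_smul, norm_smul,
    Complex.norm_real, Real.norm_of_nonneg (by positivity)]

variable (n) in
theorem norm_lpCoeff_le (σ : ℝ) : ∃ C, 0 ≤ C ∧ ∀ (β : ℝ) (T : 𝓢'(Rn n, ℂ)), besovNorm β T < ⊤ →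
    ∀ j x, ‖lpCoeff T σ j x‖ ≤ C * ((2 : ℝ) ^ j) ^ (σ + β) * (besovNorm β T).toReal := by
  obtain ⟨C, hC, h⟩ := norm_apply_shift_fourier_le (lpSymbol n σ) (hasCompactSupport_annularS σ _)
  refine ⟨C, hC, fun β T hT j x => ?_⟩
  rw [norm_lpCoeff_eq]
  calc ((2 : ℝ) ^ j) ^ σ *
        ‖T (shift x (𝓕 (dil (inv_pos.2 (two_zpow_pos j)) (lpSymbol n σ))))‖
      ≤ ((2 : ℝ) ^ j) ^ σ * (C * ((2 : ℝ) ^ j) ^ β * (besovNorm β T).toReal) := by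
        gcongr; exact h β T hT _ (two_zpow_pos j) x
    _ = _ := by rw [Real.rpow_add (two_zpow_pos j)]; ring

/-- The `j`-th dyadic piece is the difference of two consecutive truncations. -/
theorem integral_mul_lpCoeff (T : 𝓢'(Rn n, ℂ)) (σ : ℝ) (j : ℤ) (φ : 𝓢(Rn n, ℂ)) :
    ∫ x, φ x * lpCoeff T σ j x = T (multOp (truncSymbol σ (bump (Rn n)) (2 ^ (j - 1))) φ) -
      T (multOp (truncSymbol σ (bump (Rn n)) (2 ^ j)) φ) := by
  rw [← map_sub, ← multOp_sub (hasTemperateGrowth_truncSymbol σ isCutoff_bump (two_zpow_pos _))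
    (hasTemperateGrowth_truncSymbol σ isCutoff_bump (two_zpow_pos _)), ← lpBlock_eq,
    multOp_schwartz, apply_conv]
  rfl

/-- The truncations of `|D|^σ T` to high frequencies tend to `0`: they test the Fourier transform of
`T` against the tails, outside the ball of radius `2^N`, of one Schwartz function. -/
theorem tendsto_apply_multOp_truncSymbol (T : 𝓢'(Rn n, ℂ)) (σ : ℝ) (φ : 𝓢(Rn n, ℂ)) :
    Tendsto (fun N : ℕ => T (multOp (truncSymbol σ (bump (Rn n)) (2 ^ (N : ℤ))) φ)) atTop
      (𝓝 0) := by
  set ψ := SchwartzMap.smulLeftCLM ℂ (truncSymbol σ (bump (Rn n)) (2 ^ (-1 : ℤ))) (𝓕⁻ φ) with hψ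
  have hu : ∀ N : ℕ, (0 : ℝ) < 2 ^ N := fun N => by positivity
  have h := tendsto_apply_head (𝓕 T) ψ hu (tendsto_pow_atTop_atTop_of_one_lt one_lt_two)
  have h2 := (tendsto_const_nhds (x := (𝓕 T) ψ)).sub h
  rw [sub_self] at h2
  refine h2.congr fun N => ?_
  rw [← map_sub, TemperedDistribution.fourier_apply, multOp]
  congr 2
  ext ξ
  change ψ ξ - head (hu N) ψ ξ = _
  rw [head_apply, hψ, SchwartzMap.smulLeftCLM_apply_apply
      (hasTemperateGrowth_truncSymbol σ isCutoff_bump (two_zpow_pos _)),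
    SchwartzMap.smulLeftCLM_apply_apply
      (hasTemperateGrowth_truncSymbol σ isCutoff_bump (two_zpow_pos _)), smul_eq_mul, smul_eq_mul,
    truncSymbol, truncSymbol, zpow_natCast]
  rcases le_or_gt ‖ξ‖ 1 with hξ | hξ
  · have h1 : bump (Rn n) (((2 : ℝ) ^ N)⁻¹ • ξ) = 1 := by
      refine bump_eq_one ?_
      rw [norm_smul, norm_inv, Real.norm_of_nonneg (hu N).le]
      exact mul_le_one₀ (inv_le_one_of_one_le₀ (one_le_pow₀ one_le_two)) (norm_nonneg _) hξ
    rw [h1]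
    push_cast
    ring
  · have h1 : bump (Rn n) (((2 : ℝ) ^ (-1 : ℤ))⁻¹ • ξ) = 0 := by
      refine bump_eq_zero ?_
      rw [norm_smul, zpow_neg_one, inv_inv, Real.norm_of_nonneg two_pos.le]
      linarith
    rw [h1]
    push_cast
    ring

/-- Truncating `|D|^σ T` to low frequencies recovers the fractional Laplacian. -/
theorem IsFracLaplacian.tendsto {T U : 𝓢'(Rn n, ℂ)} {σ : ℝ} (hU : IsFracLaplacian σ T U)
    (φ : 𝓢(Rn n, ℂ)) {u : ℕ → ℝ} (hu : ∀ N, 0 < u N) (hu0 : Tendsto u atTop (𝓝 0)) :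
    Tendsto (fun N : ℕ => T (multOp (truncSymbol σ (bump (Rn n)) (u N)) φ)) atTop (𝓝 (U φ)) := by
  have hb := isCutoff_bump (n := n)
  have h := hU _ hb.smooth hb.hasCompactSupport hb.eventually_eq_one
  rw [PointwiseConvergenceCLM.tendsto_iff_forall_tendsto] at h
  exact (h φ).comp (tendsto_nhdsWithin_iff.2 ⟨hu0, Eventually.of_forall hu⟩)

theorem tendsto_two_zpow_neg : Tendsto (fun N : ℕ => (2 : ℝ) ^ (-(N : ℤ))) atTop (𝓝 0) := by
  have h := tendsto_pow_atTop_nhds_zero_of_lt_one (r := (2 : ℝ)⁻¹) (by norm_num) (by norm_num)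
  refine h.congr fun N => ?_
  rw [zpow_neg, zpow_natCast, inv_pow]

theorem sum_Ioc_sub (c : ℤ → ℂ) (N : ℕ) :
    ∑ j ∈ Finset.Ioc (-(N : ℤ)) N, (c (j - 1) - c j) = c (-N) - c N := by
  induction N with
  | zero => simp
  | succ N ih =>
    have h : Finset.Ioc (-((N + 1 : ℕ) : ℤ)) ((N + 1 : ℕ) : ℤ) =
        insert ((N : ℤ) + 1) (insert (-(N : ℤ)) (Finset.Ioc (-(N : ℤ)) N)) := by
      ext j
      simp only [Finset.mem_Ioc, Finset.mem_insert]
      push_cast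
      omega
    rw [h, Finset.sum_insert (by simp only [Finset.mem_insert, Finset.mem_Ioc]; omega),
      Finset.sum_insert (by simp), ih]
    have h1 : (N : ℤ) + 1 - 1 = N := by ring
    have h2 : -(N : ℤ) - 1 = -((N + 1 : ℕ) : ℤ) := by push_cast; ring
    rw [h1, h2]
    push_cast
    ring

theorem tendsto_Ioc_neg_atTop : Tendsto (fun N : ℕ => Finset.Ioc (-(N : ℤ)) N) atTop atTop := by
  refine tendsto_atTop_finset_of_monotone (fun M N h => ?_) fun j => ⟨j.natAbs + 1, ?_⟩
  · exact Finset.Ioc_subset_Ioc (by simpa using h) (by simpa using h)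
  · simp only [Finset.mem_Ioc]
    omega

theorem summable_pow_natAbs {r : ℝ} (hr0 : 0 ≤ r) (hr1 : r < 1) :
    Summable fun j : ℤ => r ^ j.natAbs := by
  refine Summable.of_nat_of_neg ?_ ?_ <;>
  simpa using summable_geometric_of_lt_one hr0 hr1

/-- For a smooth function in `Ḃ^{-β,∞}_∞` the dyadic pieces of `|D|^σ T` are summable, locally
uniformly: the Besov norm controls the low frequencies, smoothness the high ones. -/
theorem exists_summable_bound {T : 𝓢'(Rn n, ℂ)} {f : Rn n → ℂ} (hf : ContDiff ℝ ∞ f)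
    (hT : IsRepresentedBy T f) {β σ : ℝ} (hσβ : 0 < σ + β) (hB : besovNorm β T < ⊤) (ρ : ℝ) :
    ∃ u : ℤ → ℝ, Summable u ∧ ∀ j x, ‖x‖ ≤ ρ → ‖lpCoeff T σ j x‖ ≤ u j := by
  obtain ⟨C₁, hC₁, h₁⟩ := norm_lpCoeff_le n σ
  obtain ⟨m, hm⟩ := exists_nat_ge (σ + 1)
  obtain ⟨C₂, hC₂, h₂⟩ := exists_decay_of_contDiff m hf hT σ
    ((isCutoff_bump.comp_smul one_pos).sub (isCutoff_bump.comp_smul (half_pos one_pos))) ρ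
  set A := (besovNorm β T).toReal
  have hA : 0 ≤ A := ENNReal.toReal_nonneg
  set r₁ : ℝ := (1 / 2 : ℝ) ^ (σ + β) with hr₁
  have hr₁0 : 0 < r₁ := by positivity
  have hr₁1 : r₁ < 1 := Real.rpow_lt_one (by norm_num) (by norm_num) hσβ
  refine ⟨fun j => C₁ * A * r₁ ^ j.natAbs + C₂ * (1 / 2 : ℝ) ^ j.natAbs,
    ((summable_pow_natAbs hr₁0.le hr₁1).mul_left _).add
      ((summable_pow_natAbs (by norm_num) (by norm_num)).mul_left _), fun j x hx => ?_⟩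
  rcases Int.eq_nat_or_neg j with ⟨k, rfl | rfl⟩
  · refine le_add_of_nonneg_of_le (by positivity) ?_
    rw [norm_lpCoeff_eq]
    have h3 := h₂ (2 ^ (k : ℤ)) (two_zpow_pos _) (one_le_zpow₀ one_le_two (by omega)) x hx
    have h4 : ((2 : ℝ) ^ (k : ℤ)) ^ σ * ((((2 : ℝ) ^ (k : ℤ))⁻¹ ^ 2) ^ m) ≤ (1 / 2) ^ k := by
      have h5 : (1 : ℝ) ≤ 2 ^ k := one_le_pow₀ one_le_two
      rw [zpow_natCast, ← pow_mul, inv_pow, ← Real.rpow_natCast _ (2 * m),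
        ← Real.rpow_neg (by positivity), ← Real.rpow_add (by positivity), one_div, inv_pow,
        ← Real.rpow_neg_one]
      refine Real.rpow_le_rpow_of_exponent_le h5 ?_
      have hm0 : (0 : ℝ) ≤ m := Nat.cast_nonneg m
      push_cast
      linarith
    calc ((2 : ℝ) ^ (k : ℤ)) ^ σ * _
        ≤ ((2 : ℝ) ^ (k : ℤ)) ^ σ * (C₂ * ((((2 : ℝ) ^ (k : ℤ))⁻¹ ^ 2) ^ m)) := by gcongr; exact h3
      _ = C₂ * (((2 : ℝ) ^ (k : ℤ)) ^ σ * ((((2 : ℝ) ^ (k : ℤ))⁻¹ ^ 2) ^ m)) := by ring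
      _ ≤ C₂ * (1 / 2) ^ k := by gcongr
      _ = _ := by simp
  · refine le_add_of_le_of_nonneg ((h₁ β T hB _ x).trans (le_of_eq ?_)) (by positivity)
    have h3 : ((2 : ℝ) ^ (-(k : ℤ))) ^ (σ + β) = r₁ ^ k := by
      rw [hr₁, zpow_neg, zpow_natCast, ← inv_pow, ← one_div, ← Real.rpow_natCast,
        ← Real.rpow_natCast, ← Real.rpow_mul (by norm_num), ← Real.rpow_mul (by norm_num), mul_comm]
    rw [h3, Int.natAbs_neg, Int.natAbs_natCast]
    ring

/-- The pointwise sum of the dyadic pieces of `|D|^σ T`. -/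
def lpSum (T : 𝓢'(Rn n, ℂ)) (σ : ℝ) (x : Rn n) : ℂ := ∑' j, lpCoeff T σ j x

theorem continuous_lpSum {T : 𝓢'(Rn n, ℂ)} {f : Rn n → ℂ} (hf : ContDiff ℝ ∞ f)
    (hT : IsRepresentedBy T f) {β σ : ℝ} (hσβ : 0 < σ + β) (hB : besovNorm β T < ⊤) :
    Continuous (lpSum T σ) := by
  rw [continuous_iff_continuousAt]
  intro x
  obtain ⟨u, hu, h⟩ := exists_summable_bound hf hT hσβ hB (‖x‖ + 1)
  have hc : ContinuousOn (lpSum T σ) (Metric.ball 0 (‖x‖ + 1)) :=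
    continuousOn_tsum (fun j => (continuous_lpCoeff T σ j).continuousOn) hu
      fun j y hy => h j y (mem_ball_zero_iff.1 hy).le
  exact hc.continuousAt (Metric.isOpen_ball.mem_nhds (by simp))

/-- The fractional Laplacian of a smooth function in `Ḃ^{-β,∞}_∞` is the pointwise sum of its
dyadic pieces. -/
theorem IsFracLaplacian.isRepresentedBy {T U : 𝓢'(Rn n, ℂ)} {f : Rn n → ℂ} (hf : ContDiff ℝ ∞ f)
    (hT : IsRepresentedBy T f) {β σ : ℝ} (hσβ : 0 < σ + β) (hB : besovNorm β T < ⊤)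
    (hU : IsFracLaplacian σ T U) : IsRepresentedBy U (lpSum T σ) := by
  refine ⟨(continuous_lpSum hf hT hσβ hB).locallyIntegrable, fun φ hφ => ?_⟩
  obtain ⟨ρ, hρ⟩ := (Metric.isBounded_iff_subset_closedBall 0).1 hφ.isBounded
  obtain ⟨u, hu, h⟩ := exists_summable_bound hf hT hσβ hB ρ
  have hle : ∀ j x, ‖φ x * lpCoeff T σ j x‖ ≤ u j * ‖φ x‖ := fun j x => by
    rw [norm_mul, mul_comm]
    by_cases hx : x ∈ tsupport φ
    · exact mul_le_mul_of_nonneg_right (h j x (mem_closedBall_zero_iff.1 (hρ hx))) (norm_nonneg _)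
    · rw [image_eq_zero_of_notMem_tsupport hx, norm_zero, mul_zero, mul_zero]
  have hint : ∀ j, Integrable fun x => φ x * lpCoeff T σ j x := fun j =>
    (φ.integrable.norm.const_mul (u j)).mono'
      (φ.continuous.mul (continuous_lpCoeff T σ j)).aestronglyMeasurable (ae_of_all _ (hle j))
  have hsum : Summable fun j => ∫ x, ‖φ x * lpCoeff T σ j x‖ := by
    refine Summable.of_nonneg_of_le (fun j => integral_nonneg fun _ => norm_nonneg _) (fun j => ?_)
      (hu.mul_right (∫ x, ‖φ x‖))
    rw [← integral_const_mul]
    exact integral_mono (hint j).norm (φ.integrable.norm.const_mul (u j)) (hle j)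
  have key := hasSum_integral_of_summable_integral_norm hint hsum
  simp only [tsum_mul_left, integral_mul_lpCoeff] at key
  have h1 := key.comp tendsto_Ioc_neg_atTop
  have h2 : Tendsto (fun N : ℕ => T (multOp (truncSymbol σ (bump (Rn n)) (2 ^ (-(N : ℤ)))) φ) -
      T (multOp (truncSymbol σ (bump (Rn n)) (2 ^ (N : ℤ))) φ)) atTop (𝓝 (U φ - 0)) :=
    (hU.tendsto φ (fun N => two_zpow_pos _) tendsto_two_zpow_neg).sub
      (tendsto_apply_multOp_truncSymbol T σ φ)
  rw [sub_zero] at h2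
  refine tendsto_nhds_unique h2 (h1.congr fun N => ?_)
  exact sum_Ioc_sub (fun j => T (multOp (truncSymbol σ (bump (Rn n)) (2 ^ j)) φ)) N

end LittlewoodPaley

/-! ### Bounds by the maximal function -/

section Maximal

variable {n : ℕ}

variable (n) in
/-- The radially decreasing function `R ^ n (1 + R|y|) ^ (-(n + 1))`. -/
def radialMajorant (R : ℝ) (y : Rn n) : ℝ := R ^ n * (1 + R * ‖y‖) ^ (-((n : ℝ) + 1))

theorem radialMajorant_nonneg {R : ℝ} (hR : 0 < R) (y : Rn n) : 0 ≤ radialMajorant n R y := by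
  unfold radialMajorant
  positivity

theorem continuous_radialMajorant {R : ℝ} (hR : 0 < R) : Continuous (radialMajorant n R) := by
  refine continuous_const.mul (Continuous.rpow_const (by fun_prop) fun y => Or.inl ?_)
  positivity

/-- The superlevel sets of the majorant are balls. -/
theorem superlevel_radialMajorant {R : ℝ} (hR : 0 < R) (x : Rn n) {l : ℝ} (hl : 0 < l) :
    ∃ r, {y | l < radialMajorant n R (y - x)} = Metric.ball x r := by
  have hn : (0 : ℝ) < (n : ℝ) + 1 := by positivity
  refine ⟨((R ^ n / l) ^ ((n : ℝ) + 1)⁻¹ - 1) / R, ?_⟩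
  ext y
  have h1 : 0 < 1 + R * ‖y - x‖ := by positivity
  rw [Set.mem_ofPred_eq, mem_ball_iff_norm, lt_div_iff₀ hR, lt_sub_iff_add_lt,
    Real.lt_rpow_inv_iff_of_pos (by positivity) (by positivity) hn, radialMajorant,
    Real.rpow_neg h1.le, lt_div_iff₀ hl, ← div_eq_mul_inv, lt_div_iff₀ (by positivity),
    mul_comm l, mul_comm R, add_comm]

variable (n) in
/-- The `L¹` norm of the majorant, which does not depend on `R`. -/
def radialMass : ℝ := ∫ y : Rn n, radialMajorant n 1 y

theorem integrable_radialMajorant {R : ℝ} (hR : 0 < R) : Integrable (radialMajorant n R) := by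
  have h : Integrable fun y : Rn n => (1 + ‖y‖) ^ (-((n : ℝ) + 1)) :=
    integrable_one_add_norm (by rw [finrank_euclideanSpace_fin]; linarith)
  have h2 := (h.comp_smul hR.ne').const_mul (R ^ n)
  refine h2.congr (ae_of_all _ fun y => ?_)
  simp only [radialMajorant, norm_smul, Real.norm_of_nonneg hR.le]

theorem lintegral_radialMajorant {R : ℝ} (hR : 0 < R) (x : Rn n) :
    ∫⁻ y, ENNReal.ofReal (radialMajorant n R (y - x)) = ENNReal.ofReal (radialMass n) := by
  rw [lintegral_sub_right_eq_self (fun y => ENNReal.ofReal (radialMajorant n R y)) x,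
    ← ofReal_integral_eq_lintegral_ofReal (integrable_radialMajorant hR)
      (ae_of_all _ fun y => radialMajorant_nonneg hR y)]
  congr 1
  have h := Measure.integral_comp_smul (volume : Measure (Rn n)) (radialMajorant n 1) R
  rw [finrank_euclideanSpace_fin, abs_of_pos (by positivity), smul_eq_mul] at h
  rw [radialMass, ← mul_right_inj' (inv_ne_zero (pow_pos hR n).ne'), ← h, ← integral_const_mul]
  congr 1
  funext y
  simp only [radialMajorant, norm_smul, Real.norm_of_nonneg hR.le, one_pow, one_mul]
  rw [← mul_assoc, inv_mul_cancel₀ (by positivity), one_mul]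

/-- Averages against a radially decreasing kernel are bounded by the maximal function: by the
layer-cake formula they are superpositions of averages over balls. -/
theorem lintegral_radialMajorant_mul_le {g : Rn n → ℂ} (hg : Measurable g) {R : ℝ} (hR : 0 < R)
    (x : Rn n) : ∫⁻ y, ENNReal.ofReal (radialMajorant n R (y - x)) * ‖g y‖ₑ ≤
      ENNReal.ofReal (radialMass n) * hlMaximal g x := by
  have hmeas : Measurable fun y => radialMajorant n R (y - x) :=
    ((continuous_radialMajorant hR).comp (continuous_sub_right x)).measurable
  have hnn : ∀ y, 0 ≤ radialMajorant n R (y - x) := fun y => radialMajorant_nonneg hR _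
  have hball : ∀ r, ∫⁻ y in Metric.ball x r, ‖g y‖ₑ ≤
      volume (Metric.ball x r) * hlMaximal g x := fun r => by
    rcases le_or_gt r 0 with hr | hr
    · simp [Metric.ball_eq_empty.2 hr]
    · have h1 : (volume (Metric.ball x r))⁻¹ * ∫⁻ y in Metric.ball x r, ‖g y‖ₑ ≤
          hlMaximal g x := by
        unfold hlMaximal
        exact le_iSup_of_le x (le_iSup_of_le r (le_iSup_of_le (Metric.mem_ball_self hr) le_rfl))
      have h0 : volume (Metric.ball x r) ≠ 0 := (Metric.measure_ball_pos _ _ hr).ne'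
      have ht : volume (Metric.ball x r) ≠ ⊤ := measure_ball_lt_top.ne
      calc ∫⁻ y in Metric.ball x r, ‖g y‖ₑ = volume (Metric.ball x r) *
            ((volume (Metric.ball x r))⁻¹ * ∫⁻ y in Metric.ball x r, ‖g y‖ₑ) := by
            rw [← mul_assoc, ENNReal.mul_inv_cancel h0 ht, one_mul]
        _ ≤ _ := by gcongr
  have h1 : ∫⁻ y, ENNReal.ofReal (radialMajorant n R (y - x)) * ‖g y‖ₑ =
      ∫⁻ y, ENNReal.ofReal (radialMajorant n R (y - x)) ∂(volume.withDensity fun y => ‖g y‖ₑ) := by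
    rw [lintegral_withDensity_eq_lintegral_mul _ hg.enorm hmeas.ennreal_ofReal]
    simp only [Pi.mul_apply, mul_comm]
  rw [h1, lintegral_eq_lintegral_meas_lt _ (ae_of_all _ hnn) hmeas.aemeasurable,
    ← lintegral_radialMajorant hR x,
    lintegral_eq_lintegral_meas_lt _ (ae_of_all _ hnn) hmeas.aemeasurable]
  have hvol : Measurable fun l => volume {y | l < radialMajorant n R (y - x)} :=
    Antitone.measurable fun a b hab => measure_mono fun y hy => lt_of_le_of_lt hab hy
  refine (setLIntegral_mono' measurableSet_Ioi fun l hl => ?_).trans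
    (le_of_eq (lintegral_mul_const _ hvol))
  obtain ⟨r, hr⟩ := superlevel_radialMajorant hR x (Set.mem_Ioi.1 hl)
  rw [hr, withDensity_apply _ measurableSet_ball]
  exact hball r

/-- Schwartz functions are dominated by the majorant. -/
theorem exists_norm_le_radialMajorant (K : 𝓢(Rn n, ℂ)) :
    ∃ C, 0 ≤ C ∧ ∀ y, ‖K y‖ ≤ C * radialMajorant n 1 y := by
  obtain ⟨C, hC, h⟩ := pow_mul_iteratedFDeriv_le (n + 1) 0 K
  refine ⟨C, hC, fun y => ?_⟩
  have h1 := h y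
  have h2 : (0 : ℝ) < 1 + ‖y‖ := by positivity
  rw [norm_iteratedFDeriv_zero] at h1
  rw [radialMajorant, one_pow, one_mul, one_mul, Real.rpow_neg h2.le,
    ← Nat.cast_add_one, Real.rpow_natCast, ← div_eq_mul_inv, le_div_iff₀ (by positivity), mul_comm]
  exact h1

/-- A distribution represented by a function whose maximal function is finite somewhere is given
by integration against all Schwartz functions. -/
theorem IsRepresentedBy.apply_eq_integral {U : 𝓢'(Rn n, ℂ)} {g : Rn n → ℂ} (hg : Continuous g)
    (hU : IsRepresentedBy U g) {x : Rn n} (hM : hlMaximal g x < ⊤) (φ : 𝓢(Rn n, ℂ)) :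
    U φ = ∫ y, φ y * g y := by
  have hint : Integrable fun y => ‖φ y‖ * ‖g y‖ := by
    obtain ⟨C, hC, hb⟩ := exists_norm_le_radialMajorant (shift (-x) φ)
    have hb' : ∀ y, ‖φ y‖ ≤ C * radialMajorant n 1 (y - x) := fun y => by
      have := hb (y - x)
      change ‖φ (y - x - -x)‖ ≤ _ at this
      rwa [sub_neg_eq_add, sub_add_cancel] at this
    refine ⟨(φ.continuous.norm.mul hg.norm).aestronglyMeasurable, ?_⟩
    rw [hasFiniteIntegral_iff_enorm]
    calc ∫⁻ y, ‖‖φ y‖ * ‖g y‖‖ₑ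
        ≤ ∫⁻ y, ENNReal.ofReal C *
            (ENNReal.ofReal (radialMajorant n 1 (y - x)) * ‖g y‖ₑ) := by
          refine lintegral_mono fun y => ?_
          rw [enorm_mul, enorm_norm, enorm_norm, ← mul_assoc, ← ENNReal.ofReal_mul hC]
          gcongr
          rw [← ofReal_norm]
          exact ENNReal.ofReal_le_ofReal (hb' y)
      _ = ENNReal.ofReal C * ∫⁻ y,
            ENNReal.ofReal (radialMajorant n 1 (y - x)) * ‖g y‖ₑ :=
          lintegral_const_mul' _ _ ENNReal.ofReal_ne_top
      _ ≤ ENNReal.ofReal C * (ENNReal.ofReal (radialMass n) * hlMaximal g x) := by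
          gcongr
          exact lintegral_radialMajorant_mul_le hg.measurable one_pos x
      _ < ⊤ := ENNReal.mul_lt_top ENNReal.ofReal_lt_top
          (ENNReal.mul_lt_top ENNReal.ofReal_lt_top hM)
  have hu : ∀ N : ℕ, (0 : ℝ) < N + 1 := fun N => by positivity
  have hlim : Tendsto (fun N : ℕ => (N : ℝ) + 1) atTop atTop :=
    tendsto_atTop_add_const_right _ _ tendsto_natCast_atTop_atTop
  have h1 := tendsto_apply_head U φ hu hlim
  have h2 : Tendsto (fun N : ℕ => ∫ y, head (hu N) φ y * g y) atTop (𝓝 (∫ y, φ y * g y)) := by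
    refine tendsto_integral_of_dominated_convergence (fun y => ‖φ y‖ * ‖g y‖)
      (fun N => ((head (hu N) φ).continuous.mul hg).aestronglyMeasurable) hint
      (fun N => ae_of_all _ fun y => ?_) (ae_of_all _ fun y => ?_)
    · rw [norm_mul]
      exact mul_le_mul_of_nonneg_right (norm_head_le _ _ _) (norm_nonneg _)
    · refine tendsto_const_nhds.congr' ?_
      filter_upwards [hlim.eventually_ge_atTop ‖y‖] with N hN
      rw [head_eq_self _ _ hN]
  refine tendsto_nhds_unique h1 (h2.congr fun N => ?_)
  rw [hU.2 _ (hasCompactSupport_head _ _)]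

/-- A distribution represented by `g`, tested against an `L¹`-normalised dilate of a Schwartz
kernel centred at `x`, is bounded by the maximal function of `g` at `x`. -/
theorem norm_apply_shift_le_hlMaximal (m : 𝓢(Rn n, ℂ)) :
    ∃ C, 0 ≤ C ∧ ∀ (U : 𝓢'(Rn n, ℂ)) (g : Rn n → ℂ), Continuous g → IsRepresentedBy U g →
      ∀ x, hlMaximal g x < ⊤ → ∀ (R : ℝ) (hR : 0 < R),
        ‖U (shift x (𝓕 (dil (inv_pos.2 hR) m)))‖ ≤ C * (hlMaximal g x).toReal := by
  obtain ⟨C, hC, hb⟩ := exists_norm_le_radialMajorant (𝓕 m)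
  have hmass : 0 ≤ radialMass n := integral_nonneg fun y => radialMajorant_nonneg one_pos y
  refine ⟨C * radialMass n, by positivity, fun U g hg hU x hM R hR => ?_⟩
  rw [hU.apply_eq_integral hg hM, ← ENNReal.ofReal_le_ofReal_iff (by positivity), ofReal_norm,
    ENNReal.ofReal_mul (by positivity), ENNReal.ofReal_toReal hM.ne, ENNReal.ofReal_mul hC,
    mul_assoc]
  refine (enorm_integral_le_lintegral_enorm _).trans ?_
  have hb' : ∀ y, ‖𝓕 (dil (inv_pos.2 hR) m) (y - x)‖ ≤ C * radialMajorant n R (y - x) :=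
    fun y => by
      rw [fourier_dil_inv hR, norm_mul, norm_pow, Complex.norm_real, Real.norm_of_nonneg hR.le,
        finrank_euclideanSpace_fin]
      refine (mul_le_mul_of_nonneg_left (hb _) (by positivity)).trans (le_of_eq ?_)
      simp only [radialMajorant, norm_smul, Real.norm_of_nonneg hR.le, one_pow, one_mul]
      ring
  calc ∫⁻ y, ‖shift x (𝓕 (dil (inv_pos.2 hR) m)) y * g y‖ₑ
      ≤ ∫⁻ y, ENNReal.ofReal C *
            (ENNReal.ofReal (radialMajorant n R (y - x)) * ‖g y‖ₑ) := by
        refine lintegral_mono fun y => ?_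
        rw [enorm_mul, ← mul_assoc, ← ENNReal.ofReal_mul hC]
        gcongr
        rw [← ofReal_norm]
        exact ENNReal.ofReal_le_ofReal (hb' y)
    _ = ENNReal.ofReal C * ∫⁻ y,
          ENNReal.ofReal (radialMajorant n R (y - x)) * ‖g y‖ₑ :=
        lintegral_const_mul' _ _ ENNReal.ofReal_ne_top
    _ ≤ _ := by
        gcongr
        exact lintegral_radialMajorant_mul_le hg.measurable hR x

end Maximal

/-! ### The Hedberg inequality -/

section Hedberg

variable {n : ℕ}

/-- Translations become modulations on the Fourier side. -/
theorem fourierInv_shift (x : Rn n) (φ : 𝓢(Rn n, ℂ)) (ξ : Rn n) :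
    𝓕⁻ (shift x φ) ξ = Real.fourierChar (inner ℝ x ξ) • 𝓕⁻ φ ξ := by
  have h := integral_sub_right_eq_self (μ := volume)
    (fun v => Real.fourierChar (inner ℝ (v + x) ξ) • φ v) x
  simp only [sub_add_cancel, inner_add_left, AddChar.map_add_eq_mul] at h
  rw [SchwartzMap.fourierInv_coe, SchwartzMap.fourierInv_coe, Real.fourierInv_eq,
    Real.fourierInv_eq, Circle.smul_def, ← integral_smul]
  refine h.trans (integral_congr_ae (ae_of_all _ fun v => ?_))
  simp only [Circle.smul_def, Circle.coe_mul, smul_eq_mul]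
  ring

/-- Fourier multipliers commute with translations. -/
theorem multOp_shift {m : Rn n → ℂ} (hm : m.HasTemperateGrowth) (x : Rn n) (φ : 𝓢(Rn n, ℂ)) :
    multOp m (shift x φ) = shift x (multOp m φ) := by
  have h : SchwartzMap.smulLeftCLM ℂ m (𝓕⁻ (shift x φ)) = 𝓕⁻ (shift x (multOp m φ)) := by
    ext ξ
    rw [SchwartzMap.smulLeftCLM_apply_apply hm, fourierInv_shift, fourierInv_shift, multOp,
      FourierTransform.fourierInv_fourier_eq, SchwartzMap.smulLeftCLM_apply_apply hm, smul_comm]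
  rw [multOp, h, FourierTransform.fourier_fourierInv_eq]

/-- The dyadic pieces of `|D|^{s₁} T` are obtained from `|D|^s T` by the multiplier
`|ξ|^{s₁ - s}`, which is harmless away from the origin. -/
theorem IsFracLaplacian.apply_lpBlock {T U : 𝓢'(Rn n, ℂ)} {s : ℝ} (hU : IsFracLaplacian s T U)
    (s₁ : ℝ) (j : ℤ) (x : Rn n) :
    U (shift x (𝓕 (lpBlock n (s₁ - s) j))) = lpCoeff T s₁ j x := by
  refine tendsto_nhds_unique (hU.tendsto _ (fun N => two_zpow_pos _) tendsto_two_zpow_neg)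
    (tendsto_const_nhds.congr' ?_)
  filter_upwards [eventually_ge_atTop (2 - j).toNat] with N hN
  have htg := hasTemperateGrowth_truncSymbol (n := n) s isCutoff_bump (two_zpow_pos (-(N : ℤ)))
  rw [multOp_shift htg, lpCoeff, multOp, FourierTransform.fourierInv_fourier_eq]
  congr 3
  ext ξ
  rw [SchwartzMap.smulLeftCLM_apply_apply htg, lpBlock_apply, lpBlock_apply, truncSymbol,
    smul_eq_mul, ← Complex.ofReal_mul]
  congr 1
  rcases le_or_gt ‖ξ‖ (2 ^ (j - 1)) with hξ | hξ
  · -- below the frequency `2 ^ (j - 1)` the dyadic piece vanishes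
    have h1 : bump (Rn n) (((2 : ℝ) ^ (j - 1))⁻¹ • ξ) = 1 := by
      refine bump_eq_one ?_
      rw [norm_smul, norm_inv, Real.norm_of_nonneg (two_zpow_pos _).le, ← div_eq_inv_mul,
        div_le_one (two_zpow_pos _)]
      exact hξ
    have h2 : bump (Rn n) (((2 : ℝ) ^ j)⁻¹ • ξ) = 1 := by
      refine bump_eq_one ?_
      rw [norm_smul, norm_inv, Real.norm_of_nonneg (two_zpow_pos _).le, ← div_eq_inv_mul,
        div_le_one (two_zpow_pos _)]
      exact hξ.trans (zpow_le_zpow_right₀ one_le_two (by omega))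
    rw [h1, h2]
    ring
  · -- above it the truncation of `|ξ|^s` is not felt
    have hpos : 0 < ‖ξ‖ := (two_zpow_pos _).trans hξ
    have h1 : bump (Rn n) (((2 : ℝ) ^ (-(N : ℤ)))⁻¹ • ξ) = 0 := by
      refine bump_eq_zero ?_
      rw [norm_smul, norm_inv, Real.norm_of_nonneg (two_zpow_pos _).le, ← div_eq_inv_mul,
        le_div_iff₀ (two_zpow_pos _)]
      refine le_trans ?_ hξ.le
      rw [← zpow_one_add₀ two_ne_zero]
      refine zpow_le_zpow_right₀ one_le_two ?_
      have := Int.toNat_le.1 hN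
      omega
    have h2 : (2 * Real.pi * ‖ξ‖) ^ s₁ =
        (2 * Real.pi * ‖ξ‖) ^ s * (2 * Real.pi * ‖ξ‖) ^ (s₁ - s) := by
      rw [← Real.rpow_add (by positivity)]
      congr 1
      ring
    rw [h1, h2]
    ring

/-- Summation of the two dyadic bounds `2^{ja} A` and `2^{-jb} M`, balanced at the scale
`2^j ≈ (M / A)^{1/(a+b)}`. -/
theorem tsum_min_le {a b : ℝ} (ha : 0 < a) (hb : 0 < b) :
    ∃ C, 0 ≤ C ∧ ∀ (A M : ℝ) (v : ℤ → ℝ), 0 ≤ A → 0 ≤ M → (∀ j, 0 ≤ v j) →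
      (∀ j, v j ≤ ((2 : ℝ) ^ j) ^ a * A) → (∀ j, v j ≤ ((2 : ℝ) ^ j) ^ (-b) * M) →
        Summable v ∧ ∑' j, v j ≤ C * (M ^ (a / (a + b)) * A ^ (b / (a + b))) := by
  have hab : 0 < a + b := add_pos ha hb
  -- the factor `2 ^ b` pays for rounding the balancing scale to a power of `2`
  let w : ℤ → ℝ := fun i => min (((2 : ℝ) ^ i) ^ a) (2 ^ b * ((2 : ℝ) ^ i) ^ (-b))
  have hw0 : ∀ i, 0 ≤ w i := fun i => le_min (by positivity) (by positivity)
  have hw : Summable w := by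
    have hr : ∀ c : ℝ, 0 < c → Summable fun k : ℕ => ((1 / 2 : ℝ) ^ c) ^ k := fun c hc =>
      summable_geometric_of_lt_one (by positivity)
        (Real.rpow_lt_one (by norm_num) (by norm_num) hc)
    have hp : ∀ (c : ℝ) (k : ℕ), ((2 : ℝ) ^ (k : ℤ)) ^ (-c) = ((1 / 2 : ℝ) ^ c) ^ k := fun c k => by
      rw [zpow_natCast, Real.rpow_neg (by positivity), ← Real.inv_rpow (by positivity), ← inv_pow,
        ← one_div, ← Real.rpow_natCast, ← Real.rpow_natCast, ← Real.rpow_mul (by norm_num),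
        ← Real.rpow_mul (by norm_num), mul_comm]
    have hq : ∀ (c : ℝ) (k : ℕ), ((2 : ℝ) ^ (-(k : ℤ))) ^ c = ((1 / 2 : ℝ) ^ c) ^ k := fun c k => by
      rw [← hp, zpow_neg, Real.inv_rpow (by positivity), Real.rpow_neg (by positivity)]
    refine Summable.of_nat_of_neg ?_ ?_
    · refine Summable.of_nonneg_of_le (fun k => hw0 _) (fun k => ?_) ((hr b hb).mul_left (2 ^ b))
      rw [← hp]
      exact min_le_right _ _
    · refine Summable.of_nonneg_of_le (fun k => hw0 _) (fun k => ?_) (hr a ha)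
      rw [← hq]
      exact min_le_left _ _
  refine ⟨∑' i, w i, tsum_nonneg hw0, fun A M v hA hM hv h1 h2 => ?_⟩
  set Q := M ^ (a / (a + b)) * A ^ (b / (a + b)) with hQ
  have hQ0 : 0 ≤ Q := by positivity
  rcases hA.eq_or_lt with rfl | hA'
  · have hz : v = 0 := funext fun j => le_antisymm (by simpa using h1 j) (hv j)
    rw [hz]
    exact ⟨summable_zero, by simpa using mul_nonneg (tsum_nonneg hw0) hQ0⟩
  rcases hM.eq_or_lt with rfl | hM'
  · have hz : v = 0 := funext fun j => le_antisymm (by simpa using h2 j) (hv j)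
    rw [hz]
    exact ⟨summable_zero, by simpa using mul_nonneg (tsum_nonneg hw0) hQ0⟩
  set lam : ℝ := (M / A) ^ (a + b)⁻¹ with hlam
  have hlam0 : 0 < lam := by positivity
  have hQa : lam ^ a * A = Q := by
    rw [hlam, ← Real.rpow_mul (by positivity), Real.div_rpow hM hA, hQ, div_mul_eq_mul_div,
      mul_div_assoc]
    have e1 : (a + b)⁻¹ * a = a / (a + b) := by ring
    have e2 : b / (a + b) = 1 - a / (a + b) := by field_simp; ring
    rw [e1, e2, Real.rpow_sub hA', Real.rpow_one]
  have hQb : lam ^ (-b) * M = Q := by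
    rw [hlam, ← Real.rpow_mul (by positivity), Real.div_rpow hM hA, hQ]
    have e1 : (a + b)⁻¹ * -b = -(b / (a + b)) := by ring
    have e2 : a / (a + b) = 1 - b / (a + b) := by field_simp; ring
    rw [e1, e2, Real.rpow_sub hM', Real.rpow_one, Real.rpow_neg hM, Real.rpow_neg hA]
    field_simp
  obtain ⟨J, hJ1, hJ2⟩ := exists_mem_Ico_zpow hlam0 one_lt_two
  have hshift : ∀ (j : ℤ) (c : ℝ),
      ((2 : ℝ) ^ j) ^ c = ((2 : ℝ) ^ (j - J)) ^ c * ((2 : ℝ) ^ J) ^ c :=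
    fun j c => by
      rw [← Real.mul_rpow (by positivity) (by positivity), ← zpow_add₀ two_ne_zero, sub_add_cancel]
  have hle : ∀ j, v j ≤ Q * w (j - J) := fun j => by
    rw [mul_min_of_nonneg _ _ hQ0]
    refine le_min ((h1 j).trans ?_) ((h2 j).trans ?_)
    · rw [hshift j a, ← hQa]
      calc ((2 : ℝ) ^ (j - J)) ^ a * ((2 : ℝ) ^ J) ^ a * A
          ≤ ((2 : ℝ) ^ (j - J)) ^ a * lam ^ a * A := by gcongr
        _ = _ := by ring
    · rw [hshift j (-b), ← hQb]
      have h3 : ((2 : ℝ) ^ J) ^ (-b) ≤ 2 ^ b * lam ^ (-b) := by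
        have h4 : lam / 2 ≤ 2 ^ J := by
          rw [zpow_add_one₀ two_ne_zero] at hJ2
          linarith
        calc ((2 : ℝ) ^ J) ^ (-b) ≤ (lam / 2) ^ (-b) :=
              Real.rpow_le_rpow_of_nonpos (by positivity) h4 (by linarith)
          _ = _ := by
            rw [Real.div_rpow hlam0.le two_pos.le, Real.rpow_neg two_pos.le b, div_inv_eq_mul,
              mul_comm]
      calc ((2 : ℝ) ^ (j - J)) ^ (-b) * ((2 : ℝ) ^ J) ^ (-b) * M
          ≤ ((2 : ℝ) ^ (j - J)) ^ (-b) * (2 ^ b * lam ^ (-b)) * M := by gcongr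
        _ = _ := by ring
  have hws : Summable fun j : ℤ => Q * w (j - J) :=
    ((Equiv.subRight J).summable_iff.2 hw).mul_left Q
  have hvs : Summable v := Summable.of_nonneg_of_le hv hle hws
  refine ⟨hvs, (hvs.tsum_le_tsum hle hws).trans (le_of_eq ?_)⟩
  rw [tsum_mul_left, mul_comm]
  exact congrArg (· * Q) ((Equiv.subRight J).tsum_eq w)

variable (n) in
/-- The pointwise interpolation inequality between the maximal function of `g = |D|^s T` and the
Besov norm of `T`, at a point where the maximal function is finite. -/
theorem exists_hedberg_bound {s₁ s β : ℝ} (hs₁s : s₁ < s) (hβ : 0 < s₁ + β) :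
    ∃ C, 0 < C ∧ ∀ (T U : 𝓢'(Rn n, ℂ)) (g : Rn n → ℂ), besovNorm β T < ⊤ →
      IsFracLaplacian s T U → Continuous g → IsRepresentedBy U g → ∀ x, hlMaximal g x < ⊤ →
        ‖lpSum T s₁ x‖ ≤ C * ((hlMaximal g x).toReal ^ ((s₁ + β) / (s + β)) *
          (besovNorm β T).toReal ^ ((s - s₁) / (s + β))) := by
  obtain ⟨C₁, hC₁, h₁⟩ := norm_lpCoeff_le n s₁
  obtain ⟨C₂, hC₂, h₂⟩ := norm_apply_shift_le_hlMaximal (lpSymbol n (s₁ - s))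
  obtain ⟨C₃, hC₃, h₃⟩ := tsum_min_le hβ (sub_pos.2 hs₁s)
  set D := C₁ + C₂ + 1 with hD
  have hD0 : 0 < D := by positivity
  refine ⟨D * (C₃ + 1), by positivity, fun T U g hT hU hg hUg x hM => ?_⟩
  set A := (besovNorm β T).toReal
  set M := (hlMaximal g x).toReal
  have hA : 0 ≤ A := ENNReal.toReal_nonneg
  have hM0 : 0 ≤ M := ENNReal.toReal_nonneg
  obtain ⟨hsum, hle⟩ := h₃ A M (fun j => D⁻¹ * ‖lpCoeff T s₁ j x‖) hA hM0
    (fun j => by positivity)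
    (fun j => by
      rw [inv_mul_le_iff₀ hD0]
      refine (h₁ β T hT j x).trans ?_
      rw [mul_assoc]
      gcongr
      linarith)
    (fun j => by
      rw [inv_mul_le_iff₀ hD0, ← hU.apply_lpBlock]
      have h4 := h₂ U g hg hUg x hM (2 ^ j) (two_zpow_pos j)
      have h5 := norm_lpCoeff_eq U (s₁ - s) j x
      rw [lpCoeff] at h5
      rw [h5, neg_sub]
      calc ((2 : ℝ) ^ j) ^ (s₁ - s) *
            ‖U (shift x (𝓕 (dil (inv_pos.2 (two_zpow_pos j)) (lpSymbol n (s₁ - s)))))‖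
          ≤ ((2 : ℝ) ^ j) ^ (s₁ - s) * (D * M) := by
            gcongr
            exact h4.trans (by gcongr; linarith)
        _ = _ := by ring)
  rw [show s₁ + β + (s - s₁) = s + β by ring] at hle
  set Q := M ^ ((s₁ + β) / (s + β)) * A ^ ((s - s₁) / (s + β))
  have hQ : 0 ≤ Q := by positivity
  have hs : Summable fun j => ‖lpCoeff T s₁ j x‖ := by
    have := hsum.mul_left D
    simpa [mul_inv_cancel_left₀ hD0.ne'] using this
  rw [tsum_mul_left, inv_mul_le_iff₀ hD0] at hle
  calc ‖lpSum T s₁ x‖ ≤ ∑' j, ‖lpCoeff T s₁ j x‖ := norm_tsum_le_tsum_norm hs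
    _ ≤ D * (C₃ * Q) := hle
    _ ≤ D * ((C₃ + 1) * Q) := by gcongr; linarith
    _ = _ := by ring

/-- If the Besov norm vanishes, so do all dyadic pieces. -/
theorem lpSum_eq_zero {T : 𝓢'(Rn n, ℂ)} {β : ℝ} (hT : besovNorm β T = 0) (σ : ℝ) (x : Rn n) :
    lpSum T σ x = 0 := by
  obtain ⟨C, -, h⟩ := norm_lpCoeff_le n σ
  have h0 : ∀ j, lpCoeff T σ j x = 0 := fun j => by
    have := h β T (by simp [hT]) j x
    rw [hT, ENNReal.toReal_zero, mul_zero] at this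
    exact norm_le_zero_iff.1 this
  simp [lpSum, h0]

end Hedberg

end

theorem theorem1 (n : ℕ) (s₁ s β θ : ℝ) (hs₁ : 0 < s₁) (hs₁s : s₁ < s) (hsn : s < n)
    (hβ : 0 < β) (hθ : θ = (s - s₁) / (β + s)) :
    ∃ C : ℝ, 0 < C ∧
      ∀ (f : Rn n → ℝ) (T : 𝓢'(Rn n, ℂ)), ContDiff ℝ ∞ f →
        IsRepresentedBy T (fun x => (f x : ℂ)) → besovNorm β T < ⊤ →
        ∃ g₁ g : Rn n → ℂ, Continuous g₁ ∧ Continuous g ∧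
          IsFracLaplacianFun s₁ T g₁ ∧ IsFracLaplacianFun s T g ∧
          ∀ x : Rn n, ‖g₁ x‖ₑ ^ (1 / (1 - θ)) ≤
            ENNReal.ofReal C * hlMaximal g x * besovNorm β T ^ (θ / (1 - θ)) := by
  have hσ₁ : 0 < s₁ + β := by positivity
  have hσ : 0 < s + β := by linarith
  have hθ' : 1 - θ = (s₁ + β) / (s + β) := by
    rw [hθ, add_comm β s]
    field_simp
    ring
  have hθ1 : 0 < 1 - θ := by rw [hθ']; positivity
  have hθ0 : 0 < θ := by rw [hθ]; exact div_pos (by linarith) (by linarith)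
  have hpow : 0 < 1 / (1 - θ) := by positivity
  obtain ⟨C, hC, hbound⟩ := exists_hedberg_bound n hs₁s hσ₁
  refine ⟨C ^ (1 / (1 - θ)), by positivity, fun f T hf hT hB => ?_⟩
  have hfc : ContDiff ℝ ∞ fun x => (f x : ℂ) := Complex.ofRealCLM.contDiff.comp hf
  obtain ⟨U₁, hU₁⟩ := exists_isFracLaplacian hσ₁ hB
  obtain ⟨U, hU⟩ := exists_isFracLaplacian hσ hB
  have hg := continuous_lpSum hfc hT hσ hB
  have hUg := hU.isRepresentedBy hfc hT hσ hB
  refine ⟨lpSum T s₁, lpSum T s, continuous_lpSum hfc hT hσ₁ hB, hg,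
    ⟨U₁, hU₁, hU₁.isRepresentedBy hfc hT hσ₁ hB⟩, ⟨U, hU, hUg⟩, fun x => ?_⟩
  rcases eq_or_ne (besovNorm β T) 0 with h0 | h0
  · rw [lpSum_eq_zero h0, enorm_zero, ENNReal.zero_rpow_of_pos hpow]
    exact zero_le
  rcases eq_or_ne (hlMaximal (lpSum T s) x) ⊤ with hM | hM
  · have h1 : besovNorm β T ^ (θ / (1 - θ)) ≠ 0 := by
      rw [Ne, ENNReal.rpow_eq_zero_iff]
      rintro (⟨h, -⟩ | ⟨h, -⟩)
      · exact h0 h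
      · exact hB.ne h
    rw [hM, ENNReal.mul_top (by simpa using Real.rpow_pos_of_pos hC _), ENNReal.top_mul h1]
    exact le_top
  · have h := hbound T U _ hB hU hg hUg x (lt_top_iff_ne_top.2 hM)
    rw [← hθ', show (s - s₁) / (s + β) = θ by rw [hθ, add_comm]] at h
    have h1 : ‖lpSum T s₁ x‖ₑ ≤ ENNReal.ofReal C *
        (hlMaximal (lpSum T s) x ^ (1 - θ) * besovNorm β T ^ θ) := by
      rw [← ofReal_norm]
      refine (ENNReal.ofReal_le_ofReal h).trans (le_of_eq ?_)
      rw [ENNReal.ofReal_mul hC.le, ENNReal.ofReal_mul (by positivity),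
        ← ENNReal.ofReal_rpow_of_nonneg ENNReal.toReal_nonneg hθ1.le,
        ← ENNReal.ofReal_rpow_of_nonneg ENNReal.toReal_nonneg hθ0.le, ENNReal.ofReal_toReal hM,
        ENNReal.ofReal_toReal hB.ne]
    refine (ENNReal.rpow_le_rpow h1 hpow.le).trans (le_of_eq ?_)
    rw [ENNReal.mul_rpow_of_nonneg _ _ hpow.le, ENNReal.mul_rpow_of_nonneg _ _ hpow.le,
      ENNReal.ofReal_rpow_of_pos hC, ← ENNReal.rpow_mul, ← ENNReal.rpow_mul, mul_one_div_cancel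
      hθ1.ne', ENNReal.rpow_one, mul_one_div, mul_assoc]
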